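/- Conventions. Let $d\ge 1$. A tile in $\mathbb R^d$ is a nonempty compact set equal to the closure of its interior; a tiling of $\mathbb R^d$ is a collection of tiles with pairwise disjoint interiors that covers $\mathbb R^d$; a patch of a tiling is a finite subset of it. Fix a group $\Gamma$ of linear isometries of $\mathbb R^d$ (for instance the trivial group, or all of $O(d)$). A substitution rule consists of finitely many labelled tiles $T_1,\dots,T_n$ (prototiles) and, for each $i$, a tessellation of $T_i$ by finitely many labelled rescaled copies $v+s\gamma(T_j)$ of prototiles, with $s>0$, $\gamma\in\Gamma$, $v\in\mathbb R^d$ (the copies have union $T_i$ and pairwise disjoint interiors). Multiscale rules. A substitution rule $\sigma$ is a multiscale substitution rule if all $T_i$ have unit volume and all scales satisfy $s<1$. Its associated graph is the directed multigraph with vertices $1,\dots,n$ and with an edge of length $\log(1/s)$ from $i$ to $j$ for each copy of $T_j$ of scale $s$ in the tessellation of $T_i$. The rule is irreducible if this graph is strongly connected. It is incommensurable if the graph has two closed paths of positive lengths $a,b$ with $a\notin b\mathbb Q$, and commensurable otherwise. For $t\ge 0$ let $F_t(T_i)$ be the patch obtained from $e^tT_i$ by repeatedly substituting every tile of volume greater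 than $1$ until all tiles have volume at most $1$. A multiscale substitution tiling generated by $\sigma$ is a tiling of $\mathbb R^d$ every patch of which is a limit of translated sub-patches of the patches $F_t(T_i)$, $t\ge0$, $1\le i\le n$. Primitive rules. A substitution rule $\rho$ is a fixed scale rule with inflation constant $\xi>1$ if all scales equal $\xi^{-1}$. It is primitive if some positive power of its substitution matrix, whose $(i,j)$ entry is the number of copies of $T_i$ in the tessellation of $T_j$, has only positive entries. A substitution tiling generated by $\rho$ is a labelled tiling of $\mathbb R^d$ every labelled patch of which is a limit of translated labelled sub-patches of the patches $(\xi\rho)^\ell(T_j)$, $\ell\ge0$. Here a patch $P$ is a limit of translated sub-patches of patches from a family $\mathcal G$ if for every $\varepsilon>0$ some translate of an element of $\mathcal G$ has a sub-patch in bijection with $P$, corresponding tiles being at Chabauty–Fell distance less than $\varepsilon$ (and having the same label, in the labelled case). Proposition. Let $\mathcal T$ be a multiscale substitution tiling of $\mathbb R^d$ generated by an irreducible commensurable multiscale substitution rule with isometries in $\Gamma$. Then there are a primitive fixed scale substitution rule $\rho$ with isometries in $\Gamma$, a substitution tiling $\mathcal T_{\rm prim}$ of $\mathbb R^d$ generated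 by $\rho$, and $c>0$, such that $\mathcal T=c\,\mathcal T_{\rm prim}$ after the labels of $\mathcal T_{\rm prim}$ are forgotten. Moreover, if $\Gamma$ is trivial and $\mathcal T$ has finite local complexity (for every $R$, up to translation only finitely many patches of $\mathcal T$ are contained in a ball of radius $R$), then these can be chosen so that every labelled patch of $\mathcal T_{\rm prim}$ is exactly a translated sub-patch of some $(\xi\rho)^\ell(T_j)$. -/

import Mathlib

noncomputable section

namespace MultiscaleTiling

/-- Euclidean space of dimension `d`. -/
abbrev E (d : ℕ) : Type := EuclideanSpace ℝ (Fin d)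

/-- A tile: a nonempty compact set which is the closure of its interior. -/
structure IsTile {d : ℕ} (T : Set (E d)) : Prop where
  nonempty : T.Nonempty
  isCompact : IsCompact T
  closure_interior : closure (interior T) = T

/-- The translate `v + T`. -/
def translate {d : ℕ} (v : E d) (T : Set (E d)) : Set (E d) := (fun x => v + x) '' T

/-- The dilate `c T`. -/
def dilate {d : ℕ} (c : ℝ) (T : Set (E d)) : Set (E d) := (fun x => c • x) '' T

/-! ### Rescaled copies of prototiles and substitution rules -/

/-- The data of a labelled rescaled copy of one of `n` prototiles `T₁, …, Tₙ` in `ℝ^d`: the copy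
with label `j`, scale `s`, linear isometry `γ` and shift `v` is the set `v + s γ(Tⱼ)`. -/
structure Copy (d n : ℕ) where
  label : Fin n
  scale : ℝ
  rot : E d ≃ₗᵢ[ℝ] E d
  shift : E d

/-- The subset of `ℝ^d` occupied by a copy. -/
def Copy.support {d n : ℕ} (tile : Fin n → Set (E d)) (c : Copy d n) : Set (E d) :=
  (fun x => c.shift + c.scale • c.rot x) '' tile c.label

/-- The copy `λ • c`, i.e. `c` inflated by `λ` about the origin. -/
def Copy.inflate {d n : ℕ} (r : ℝ) (c : Copy d n) : Copy d n where
  label := c.label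
  scale := r * c.scale
  rot := c.rot
  shift := r • c.shift

/-- The prototile number `i` inflated by `r`, as a copy of itself. -/
def Copy.root {d n : ℕ} (i : Fin n) (r : ℝ) : Copy d n where
  label := i
  scale := r
  rot := LinearIsometryEquiv.refl ℝ (E d)
  shift := 0

/-- A substitution rule on finitely many labelled prototiles in `ℝ^d`: every prototile `Tᵢ` is
tessellated by finitely many rescaled copies of prototiles (their union is `Tᵢ` and their interiors
are pairwise disjoint).  The linear isometries used in the copies belong to a given group `Γ` of
linear isometries (`Γ = ⊥` means that only translated rescaled copies are used). -/
structure SubstitutionRule (d : ℕ) (Γ : Subgroup (E d ≃ₗᵢ[ℝ] E d)) where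
  /-- the number of prototiles -/
  n : ℕ
  /-- the prototiles -/
  tile : Fin n → Set (E d)
  isTile : ∀ i, IsTile (tile i)
  /-- the number of tiles in the patch that replaces the `i`-th prototile -/
  num : Fin n → ℕ
  /-- the tiles of the patch that replaces the `i`-th prototile -/
  piece : (i : Fin n) → Fin (num i) → Copy d n
  scale_pos : ∀ i e, 0 < (piece i e).scale
  rot_mem : ∀ i e, (piece i e).rot ∈ Γ
  union_eq : ∀ i, (⋃ e, (piece i e).support tile) = tile i
  disjoint : ∀ i, Pairwise fun e e' =>
    Disjoint (interior ((piece i e).support tile)) (interior ((piece i e').support tile))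

namespace SubstitutionRule

variable {d : ℕ} {Γ : Subgroup (E d ≃ₗᵢ[ℝ] E d)}

/-- The `e`-th tile of the patch obtained by applying the rule to the copy `c`: the placement
of `c` applied to the `e`-th tile of the patch that replaces the prototile of `c`. -/
def sub (σ : SubstitutionRule d Γ) (c : Copy d σ.n) (e : Fin (σ.num c.label)) : Copy d σ.n where
  label := (σ.piece c.label e).label
  scale := c.scale * (σ.piece c.label e).scale
  rot := (σ.piece c.label e).rot.trans c.rot
  shift := c.shift + c.scale • c.rot (σ.piece c.label e).shift

/-! ### Multiscale substitution rules -/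

/-- A multiscale substitution rule: all prototiles have unit volume, and all copies of prototiles
used in the rule have scale less than one. -/
structure IsMultiscale (σ : SubstitutionRule d Γ) : Prop where
  volume_tile : ∀ i, MeasureTheory.volume (σ.tile i) = 1
  scale_lt_one : ∀ i e, (σ.piece i e).scale < 1

/-- `σ.Walk i j a`: in the associated directed graph there is a directed path of length `a` from
the vertex `i` to the vertex `j`.  The vertices are the prototiles; each tile of scale `α` and
label `j` in the patch replacing `Tᵢ` is an edge of length `log (1 / α)` from `i` to `j`. -/
inductive Walk (σ : SubstitutionRule d Γ) : Fin σ.n → Fin σ.n → ℝ → Prop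
  | nil (i : Fin σ.n) : Walk σ i i 0
  | cons (i : Fin σ.n) (e : Fin (σ.num i)) (j : Fin σ.n) (a : ℝ) :
      Walk σ (σ.piece i e).label j a → Walk σ i j (Real.log (1 / (σ.piece i e).scale) + a)

/-- The rule is irreducible: the associated graph is strongly connected. -/
def IsIrreducible (σ : SubstitutionRule d Γ) : Prop := ∀ i j, ∃ a, σ.Walk i j a

/-- The rule is incommensurable: the associated graph has two (nontrivial) closed paths of
lengths `a` and `b` with `a ∉ b ℚ`. -/
def IsIncommensurable (σ : SubstitutionRule d Γ) : Prop :=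
  ∃ (i j : Fin σ.n) (a b : ℝ), 0 < a ∧ 0 < b ∧ σ.Walk i i a ∧ σ.Walk j j b ∧
    ¬ ∃ q : ℚ, a = b * (q : ℝ)

/-- The rule is commensurable. -/
def IsCommensurable (σ : SubstitutionRule d Γ) : Prop := ¬ σ.IsIncommensurable

/-- `σ.Refines c c'`: the copy `c'` is one of the tiles of volume at most one obtained from the
copy `c` by substituting, repeatedly, all tiles of volume greater than one. -/
inductive Refines (σ : SubstitutionRule d Γ) : Copy d σ.n → Copy d σ.n → Prop
  | done (c : Copy d σ.n) : MeasureTheory.volume (c.support σ.tile) ≤ 1 → Refines σ c c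
  | step (c : Copy d σ.n) (e : Fin (σ.num c.label)) (c' : Copy d σ.n) :
      1 < MeasureTheory.volume (c.support σ.tile) → Refines σ (σ.sub c e) c' → Refines σ c c'

/-- The patch `F_t(Tᵢ)` of the substitution semi-flow: inflate `Tᵢ` by `e^t` and substitute
repeatedly until every tile has volume at most one. -/
def flow (σ : SubstitutionRule d Γ) (t : ℝ) (i : Fin σ.n) : Set (Copy d σ.n) :=
  {c | σ.Refines (Copy.root i (Real.exp t)) c}

/-- The generating family of patches `{F_t(Tᵢ) | t ≥ 0}`, each patch being the set of its
tiles. -/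
def generatingPatches (σ : SubstitutionRule d Γ) : Set (Set (Set (E d))) :=
  {P | ∃ (t : ℝ) (i : Fin σ.n), 0 ≤ t ∧ P = Copy.support σ.tile '' σ.flow t i}

/-! ### Fixed scale and primitive substitution rules -/

/-- A fixed scale substitution rule with inflation constant `ξ > 1`. -/
structure IsFixedScale (ρ : SubstitutionRule d Γ) (ξ : ℝ) : Prop where
  one_lt : 1 < ξ
  scale_eq : ∀ i e, (ρ.piece i e).scale = ξ⁻¹

/-- The substitution matrix: the entry `(i, j)` is the number of copies of `Tᵢ` in the patch
replacing `Tⱼ`. -/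
def matrix (ρ : SubstitutionRule d Γ) : Matrix (Fin ρ.n) (Fin ρ.n) ℤ :=
  Matrix.of fun i j => (Fintype.card {e : Fin (ρ.num j) // (ρ.piece j e).label = i} : ℤ)

/-- The rule is primitive: some positive power of the substitution matrix is strictly positive. -/
def IsPrimitive (ρ : SubstitutionRule d Γ) : Prop := ρ.matrix.IsPrimitive

/-- The map `ξρ` on patches: substitute every tile and inflate by `ξ`. -/
def inflateSub (ρ : SubstitutionRule d Γ) (ξ : ℝ) (P : Set (Copy d ρ.n)) : Set (Copy d ρ.n) :=
  {c' | ∃ c ∈ P, ∃ e, c' = (ρ.sub c e).inflate ξ}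

/-- The generating labelled patches `{(ξρ)^ℓ(Tⱼ) | ℓ ≥ 0}`, each patch being the set of its tiles
together with their labels. -/
def generatingLabelledPatches (ρ : SubstitutionRule d Γ) (ξ : ℝ) :
    Set (Set (Fin ρ.n × Set (E d))) :=
  {P | ∃ (l : ℕ) (j : Fin ρ.n),
    P = (fun c => (c.label, c.support ρ.tile)) '' ((ρ.inflateSub ξ)^[l] {Copy.root j 1})}

end SubstitutionRule

/-! ### Tilings and limits of patches -/

/-- A tiling of `ℝ^d`: a collection of tiles with pairwise disjoint interiors covering `ℝ^d`. -/
structure IsTiling {d : ℕ} (𝒯 : Set (Set (E d))) : Prop where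
  isTile : ∀ T ∈ 𝒯, IsTile T
  union_eq : ⋃₀ 𝒯 = Set.univ
  disjoint : 𝒯.Pairwise fun T T' => Disjoint (interior T) (interior T')

/-- Forget the labels of a collection of labelled tiles. -/
def forgetLabels {d n : ℕ} (𝒯 : Set (Fin n × Set (E d))) : Set (Set (E d)) := Prod.snd '' 𝒯

/-- A labelled tiling: a tiling in which each tile carries exactly one label. -/
def IsLabelledTiling {d n : ℕ} (𝒯 : Set (Fin n × Set (E d))) : Prop :=
  IsTiling (forgetLabels 𝒯) ∧ Set.InjOn Prod.snd 𝒯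

/-- The Chabauty-Fell distance of two closed subsets of `ℝ^d`: the infimum of all `0 < ε < 1`
such that, within the ball of radius `1 / ε` about the origin, each set is contained in the
`ε`-neighbourhood of the other one; it is `1` if there is no such `ε`. -/
def cfDist {d : ℕ} (A B : Set (E d)) : ℝ :=
  sInf (insert 1 {ε : ℝ | 0 < ε ∧ ε < 1 ∧
    A ∩ Metric.ball 0 (1 / ε) ⊆ Metric.thickening ε B ∧
    B ∩ Metric.ball 0 (1 / ε) ⊆ Metric.thickening ε A})

/-- The patch `P` is a limit of translated sub-patches of elements of `𝒢`: for every `ε > 0` there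
is a translate of some element of `𝒢` having a sub-patch whose tiles are in one-to-one
correspondence with those of `P`, corresponding tiles being `ε`-close. -/
def IsLimitOfTranslatedSubpatches {d : ℕ} (𝒢 : Set (Set (Set (E d)))) (P : Set (Set (E d))) :
    Prop :=
  ∀ ε > 0, ∃ G ∈ 𝒢, ∃ (v : E d) (f : Set (E d) → Set (E d)),
    Set.InjOn f P ∧ Set.MapsTo f P G ∧ ∀ T ∈ P, cfDist T (translate v (f T)) < ε

/-- The same for labelled patches; corresponding tiles have the same label. -/
def IsLimitOfTranslatedLabelledSubpatches {d n : ℕ} (𝒢 : Set (Set (Fin n × Set (E d))))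
    (P : Set (Fin n × Set (E d))) : Prop :=
  ∀ ε > 0, ∃ G ∈ 𝒢, ∃ (v : E d) (f : Fin n × Set (E d) → Fin n × Set (E d)),
    Set.InjOn f P ∧ Set.MapsTo f P G ∧
      ∀ p ∈ P, (f p).1 = p.1 ∧ cfDist p.2 (translate v (f p).2) < ε

/-- The labelled patch `P` is (exactly) a translated sub-patch of an element of `𝒢`. -/
def IsTranslatedLabelledSubpatch {d n : ℕ} (𝒢 : Set (Set (Fin n × Set (E d))))
    (P : Set (Fin n × Set (E d))) : Prop :=
  ∃ G ∈ 𝒢, ∃ v : E d, P ⊆ (fun p => (p.1, translate v p.2)) '' G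

/-- A multiscale substitution tiling generated by `σ`: a tiling of `ℝ^d` every patch of which is a
limit of translated sub-patches of generating patches. -/
structure IsMultiscaleSubstitutionTiling {d : ℕ} {Γ : Subgroup (E d ≃ₗᵢ[ℝ] E d)}
    (σ : SubstitutionRule d Γ) (𝒯 : Set (Set (E d))) : Prop where
  isTiling : IsTiling 𝒯
  isLimit : ∀ P ⊆ 𝒯, P.Finite → IsLimitOfTranslatedSubpatches σ.generatingPatches P

/-- A substitution tiling generated by the fixed scale rule `ρ` with inflation constant `ξ`: a
labelled tiling of `ℝ^d` every patch of which is a limit of translated sub-patches of generating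
labelled patches. -/
structure IsSubstitutionTiling {d : ℕ} {Γ : Subgroup (E d ≃ₗᵢ[ℝ] E d)}
    (ρ : SubstitutionRule d Γ) (ξ : ℝ) (𝒯 : Set (Fin ρ.n × Set (E d))) : Prop where
  isTiling : IsLabelledTiling 𝒯
  isLimit : ∀ P ⊆ 𝒯, P.Finite →
    IsLimitOfTranslatedLabelledSubpatches (ρ.generatingLabelledPatches ξ) P

/-- Finite local complexity: for every `R`, there are up to translation only finitely many patches
of the tiling that are contained in a ball of radius `R`. -/
def HasFiniteLocalComplexity {d : ℕ} (𝒯 : Set (Set (E d))) : Prop :=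
  ∀ R : ℝ, ∃ 𝓕 : Set (Set (Set (E d))), 𝓕.Finite ∧
    ∀ P ⊆ 𝒯, P.Finite → (∃ x, ⋃₀ P ⊆ Metric.closedBall x R) →
      ∃ F ∈ 𝓕, ∃ v : E d, P = translate v '' F

end MultiscaleTiling

end

/-! In an irreducible commensurable graph the closed paths through a vertex have lengths in `α ℕ`,
and every large multiple of `α` occurs. Hence edge lengths are integral up to a coboundary: `log (1
/ s) = u i - u j + α * w` with weights `w : ℕ`. Rescaling `Tᵢ` by `exp (u i)` and cutting an edge of
weight `w` into `w` unit segments gives a rule with the single inflation constant `exp α`: a tile in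
the interior of an edge only changes its label, a tile at the end of an edge is substituted. Edges
of weight zero are traversed at once, which terminates because `u` strictly decreases along them.
Paths of every large weight join any two vertices, so the new rule is primitive.

If the potentials are normalized to `(-α, 0]` at the phase of `t`, a descendant of `e^t Tᵢ` has
volume at most one exactly when its weight has reached a fixed threshold. Thus `F_t(Tᵢ)` stops where
an iterate of the fixed scale rule stops, and it embeds in such an iterate up to a similarity
(`exists_iter_of_refines`, `exists_labelledPatch_of_flow`). Potentials and weights depend on the
phase, which varies with the approximating patches of the tiling. Along an ultrafilter the root and
the weights become constant and the potentials converge; the limit defines the rule. The patches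
need only be rescaled by factors tending to one, and each tile acquires a limit label
(`exists_fixedScale_of_commensurable`).

For exactness, compactness of the shifts places generating patches of every level exactly in the
tiling. By primitivity every approximant of a patch then occurs in the tiling as well, so finite
local complexity leaves finitely many candidates up to translation. One of them works at every
precision, and a limit of shifts makes the agreement exact. -/

noncomputable section

namespace MultiscaleTiling

/-! ### Placements of copies -/

section Placement

open scoped Pointwise

variable {d m n : ℕ}

/-- The similarity `x ↦ v + s γ(x)` underlying a copy. -/
def Copy.place (a : Copy d m) (x : E d) : E d := a.shift + a.scale • a.rot x

/-- The image of the copy `c` under the similarity underlying the copy `a`. -/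
def Copy.act (a : Copy d m) (c : Copy d n) : Copy d n where
  label := c.label
  scale := a.scale * c.scale
  rot := c.rot.trans a.rot
  shift := a.shift + a.scale • a.rot c.shift

theorem Copy.support_eq (tile : Fin n → Set (E d)) (c : Copy d n) :
    c.support tile = c.place '' tile c.label := rfl

theorem Copy.place_act (a : Copy d m) (c : Copy d n) (x : E d) :
    (a.act c).place x = a.place (c.place x) := by
  simp [Copy.place, Copy.act, map_add, smul_add, mul_smul, add_assoc]

theorem Copy.support_act (tile : Fin n → Set (E d)) (a : Copy d m) (c : Copy d n) :
    (a.act c).support tile = a.place '' c.support tile := by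
  rw [support_eq, support_eq, Set.image_image]
  exact Set.image_congr fun x _ => place_act a c x

theorem Copy.act_assoc {k : ℕ} (a : Copy d m) (b : Copy d k) (c : Copy d n) :
    (a.act b).act c = a.act (b.act c) := by
  simp only [Copy.act, Copy.mk.injEq, true_and]
  refine ⟨by ring, rfl, ?_⟩
  simp [map_add, smul_add, mul_smul, add_assoc]

theorem Copy.inflate_eq_act (i : Fin m) (r : ℝ) (c : Copy d n) :
    c.inflate r = (Copy.root (d := d) i r).act c := by
  simp only [Copy.inflate, Copy.root, Copy.act, Copy.mk.injEq, true_and, zero_add]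
  exact ⟨rfl, rfl⟩

theorem Copy.place_root (i : Fin n) (r : ℝ) (x : E d) : (Copy.root i r).place x = r • x := by
  simp [Copy.place, Copy.root]

/-- A similarity of nonzero ratio as a homeomorphism. -/
def Copy.homeo (a : Copy d m) (h : 0 < a.scale) : E d ≃ₜ E d :=
  (a.rot.toHomeomorph.trans (Homeomorph.smulOfNeZero a.scale h.ne')).trans
    (Homeomorph.addLeft a.shift)

theorem Copy.coe_homeo (a : Copy d m) (h : 0 < a.scale) : ⇑(a.homeo h) = a.place := rfl

theorem Copy.place_injective (a : Copy d m) (h : 0 < a.scale) : Function.Injective a.place :=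
  (a.homeo h).injective

theorem Copy.interior_image (a : Copy d m) (h : 0 < a.scale) (S : Set (E d)) :
    interior (a.place '' S) = a.place '' interior S := by
  rw [← a.coe_homeo h]; exact ((a.homeo h).image_interior S).symm

theorem IsTile.image_place {T : Set (E d)} (hT : IsTile T) (a : Copy d m) (h : 0 < a.scale) :
    IsTile (a.place '' T) where
  nonempty := hT.nonempty.image _
  isCompact := by
    rw [← a.coe_homeo h]; exact hT.isCompact.image (a.homeo h).continuous
  closure_interior := by
    rw [a.interior_image h, ← a.coe_homeo h, ← (a.homeo h).image_closure, hT.closure_interior]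

theorem IsTile.interior_nonempty {T : Set (E d)} (hT : IsTile T) : (interior T).Nonempty := by
  rw [← closure_nonempty_iff, hT.closure_interior]; exact hT.nonempty

theorem dist_place (a : Copy d m) (x y : E d) :
    dist (a.place x) (a.place y) = |a.scale| * dist x y := by
  simp only [Copy.place, dist_add_left, dist_smul₀, LinearIsometryEquiv.dist_map, Real.norm_eq_abs]

theorem volume_image_place (a : Copy d m) (h : 0 < a.scale) (S : Set (E d)) :
    MeasureTheory.volume (a.place '' S) =
      ENNReal.ofReal (a.scale ^ d) * MeasureTheory.volume S := by
  have : a.place '' S = (fun x => a.shift + x) '' (a.scale • (a.rot '' S)) := by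
    rw [← Set.image_smul, Set.image_image, Set.image_image]; rfl
  rw [this, Set.image_add_left, MeasureTheory.measure_preimage_add, MeasureTheory.Measure.addHaar_smul_of_nonneg _ h.le]
  congr 1
  · simp
  · rw [LinearIsometryEquiv.image_eq_preimage_symm]
    exact (a.rot.symm.measurePreserving).measure_preimage_emb
      a.rot.symm.toHomeomorph.measurableEmbedding S

end Placement

namespace SubstitutionRule

variable {d : ℕ} {Γ : Subgroup (E d ≃ₗᵢ[ℝ] E d)} (σ : SubstitutionRule d Γ)

theorem support_sub (c : Copy d σ.n) (e : Fin (σ.num c.label)) :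
    (σ.sub c e).support σ.tile = c.place '' (σ.piece c.label e).support σ.tile :=
  Copy.support_act _ _ _

theorem iUnion_support_sub (c : Copy d σ.n) :
    ⋃ e, (σ.sub c e).support σ.tile = c.support σ.tile := by
  simp only [support_sub]
  rw [← Set.image_iUnion, σ.union_eq, Copy.support_eq]

theorem support_sub_subset (c : Copy d σ.n) (e : Fin (σ.num c.label)) :
    (σ.sub c e).support σ.tile ⊆ c.support σ.tile := by
  rw [← σ.iUnion_support_sub c]; exact Set.subset_iUnion (fun e => (σ.sub c e).support σ.tile) e

theorem disjoint_interior_sub (c : Copy d σ.n) (hc : 0 < c.scale) {e e' : Fin (σ.num c.label)}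
    (h : e ≠ e') :
    Disjoint (interior ((σ.sub c e).support σ.tile))
      (interior ((σ.sub c e').support σ.tile)) := by
  rw [support_sub, support_sub, c.interior_image hc, c.interior_image hc]
  exact (Set.disjoint_image_iff (c.place_injective hc)).2 (σ.disjoint _ h)

theorem sub_scale_pos (c : Copy d σ.n) (hc : 0 < c.scale) (e : Fin (σ.num c.label)) :
    0 < (σ.sub c e).scale := mul_pos hc (σ.scale_pos _ _)

theorem isTile_support (c : Copy d σ.n) (hc : 0 < c.scale) : IsTile (c.support σ.tile) :=
  (σ.isTile _).image_place c hc

theorem num_pos (i : Fin σ.n) : 0 < σ.num i := by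
  rcases Nat.eq_zero_or_pos (σ.num i) with h | h
  · have h1 := σ.union_eq i
    have : IsEmpty (Fin (σ.num i)) := by rw [h]; infer_instance
    rw [Set.iUnion_of_empty] at h1
    exact absurd (σ.isTile i).nonempty (by rw [← h1]; simp)
  · exact h

end SubstitutionRule

/-! ### Hausdorff closeness and the Chabauty-Fell distance -/

section Close

variable {X : Type*} [PseudoMetricSpace X]

/-- Each of two sets is contained in the `δ`-neighbourhood of the other one. -/
def Close (δ : ℝ) (A B : Set X) : Prop := A ⊆ Metric.thickening δ B ∧ B ⊆ Metric.thickening δ A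

theorem Close.mono {δ δ' : ℝ} {A B : Set X} (h : Close δ A B) (hδ : δ ≤ δ') : Close δ' A B :=
  ⟨h.1.trans (Metric.thickening_mono hδ _), h.2.trans (Metric.thickening_mono hδ _)⟩

theorem Close.trans {δ δ' : ℝ} {A B C : Set X} (h : Close δ A B) (h' : Close δ' B C) :
    Close (δ + δ') A C := by
  have key : ∀ {δ δ' : ℝ} {A B C : Set X}, A ⊆ Metric.thickening δ B →
      B ⊆ Metric.thickening δ' C → A ⊆ Metric.thickening (δ + δ') C := by
    intro δ δ' A B C h h' a ha
    obtain ⟨b, hb, hab⟩ := Metric.mem_thickening_iff.1 (h ha)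
    obtain ⟨c, hc, hbc⟩ := Metric.mem_thickening_iff.1 (h' hb)
    exact Metric.mem_thickening_iff.2 ⟨c, hc, (dist_triangle a b c).trans_lt (by linarith)⟩
  exact ⟨key h.1 h'.1, by rw [add_comm]; exact key h'.2 h.2⟩

theorem eq_of_forall_close {A B : Set X} (hA : IsClosed A) (hB : IsClosed B)
    (h : ∀ δ > 0, Close δ A B) : A = B := by
  have key : ∀ {A B : Set X}, IsClosed B → (∀ δ > 0, A ⊆ Metric.thickening δ B) → A ⊆ B := by
    intro A B hB h a ha
    rw [← hB.closure_eq, Metric.closure_eq_iInter_thickening]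
    exact Set.mem_iInter₂.2 fun δ hδ => h δ hδ ha
  exact (key hB fun δ hδ => (h δ hδ).1).antisymm (key hA fun δ hδ => (h δ hδ).2)

theorem close_image {Y : Type*} (f : Y → X) (g : Y → X) (A : Set Y) {δ : ℝ}
    (h : ∀ y ∈ A, dist (f y) (g y) < δ) : Close δ (f '' A) (g '' A) := by
  constructor
  · rintro _ ⟨y, hy, rfl⟩
    exact Metric.mem_thickening_iff.2 ⟨g y, ⟨y, hy, rfl⟩, h y hy⟩
  · rintro _ ⟨y, hy, rfl⟩
    exact Metric.mem_thickening_iff.2 ⟨f y, ⟨y, hy, rfl⟩, by rw [dist_comm]; exact h y hy⟩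

end Close

section CfDist

variable {d : ℕ}

theorem cfDist_lt_of_close {A B : Set (E d)} {δ ε : ℝ} (hδ : 0 < δ) (hδ1 : δ < 1) (hε : δ < ε)
    (h : Close δ A B) : cfDist A B < ε := by
  refine lt_of_le_of_lt (csInf_le ?_ ?_) hε
  · refine ⟨0, ?_⟩
    rintro x (rfl | hx)
    · exact zero_le_one
    · exact hx.1.le
  · exact Or.inr ⟨hδ, hδ1, Set.inter_subset_left.trans h.1, Set.inter_subset_left.trans h.2⟩

/-- For sets of bounded diameter, Chabauty-Fell closeness to a bounded set is Hausdorff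
closeness. -/
theorem exists_close_of_cfDist_lt {T : Set (E d)} (hT : Bornology.IsBounded T) (hne : T.Nonempty)
    (D : ℝ) {δ : ℝ} (hδ : 0 < δ) :
    ∃ ε > 0, ∀ A : Set (E d), (∀ x ∈ A, ∀ y ∈ A, dist x y ≤ D) → cfDist T A < ε → Close δ T A := by
  obtain ⟨R, hR⟩ := hT.subset_closedBall 0
  -- Once `1 / ε' > K`, the truncating ball contains `T`, and also `A`, which has diameter at most
  -- `D` and a point within distance one of `T`; the truncation is then void. The bound by `1` below
  -- excludes the default value of the infimum.
  set K := |R| + 1 + |D| + 1 with hK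
  have hKp : 0 < K := by positivity
  refine ⟨min (min δ 1) (1 / K), by positivity, fun A hA hlt => ?_⟩
  obtain ⟨ε', hε', hlt'⟩ := exists_lt_of_csInf_lt (Set.insert_nonempty _ _) hlt
  rcases hε' with rfl | ⟨h0, h1, hTA, hAT⟩
  · exact absurd hlt' (by simp)
  have hεδ : ε' < δ := hlt'.trans_le ((min_le_left _ _).trans (min_le_left _ _))
  have hεK : K < 1 / ε' := by
    rw [lt_one_div hKp h0]; exact hlt'.trans_le (min_le_right _ _)
  have hTb : T ⊆ Metric.ball 0 (1 / ε') := fun x hx => by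
    have := hR hx
    rw [Metric.mem_closedBall] at this
    rw [Metric.mem_ball]
    have := le_abs_self R
    have := abs_nonneg D
    linarith
  have hTA' : T ⊆ Metric.thickening ε' A := fun x hx => hTA ⟨hx, hTb hx⟩
  obtain ⟨t, ht⟩ := hne
  obtain ⟨a, ha, hta⟩ := Metric.mem_thickening_iff.1 (hTA' ht)
  have hAb : A ⊆ Metric.ball 0 (1 / ε') := fun x hx => by
    have h2 := hR ht
    rw [Metric.mem_closedBall] at h2
    rw [Metric.mem_ball]
    have h3 := hA x hx a ha
    have := le_abs_self R
    have := le_abs_self D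
    have h4 := dist_triangle4 x a t 0
    rw [dist_comm a t] at h4
    linarith
  exact ⟨hTA'.trans (Metric.thickening_mono hεδ.le _),
    fun x hx => Metric.thickening_mono hεδ.le _ (hAT ⟨hx, hAb hx⟩)⟩

theorem close_translate (A : Set (E d)) {v w : E d} {δ : ℝ} (h : dist v w < δ) :
    Close δ (translate v A) (translate w A) :=
  close_image _ _ _ fun y _ => by simpa using h

theorem isClosed_translate {A : Set (E d)} (hA : IsClosed A) (v : E d) :
    IsClosed (translate v A) :=
  (Homeomorph.addLeft v).isClosedMap _ hA

theorem translate_translate (v w : E d) (A : Set (E d)) :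
    translate v (translate w A) = translate (v + w) A := by
  simp only [translate, Set.image_image, add_assoc]

theorem translate_zero (A : Set (E d)) : translate 0 A = A := by
  simp [translate]

theorem translate_injective (v : E d) : Function.Injective (translate v : Set (E d) → _) :=
  Set.image_injective.2 (add_right_injective v)

/-- A simultaneous approximation of finitely many compact sets by one and the same translate of
given compact sets can be made exact. -/
theorem exists_eq_translate_of_close {κ : Type*} [Nonempty κ] (T A : κ → Set (E d))
    (hT : ∀ k, IsCompact (T k)) (hA : ∀ k, IsCompact (A k)) (hA0 : ∀ k, (A k).Nonempty)
    (h : ∀ δ > 0, ∃ v, ∀ k, Close δ (T k) (translate v (A k))) :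
    ∃ v, ∀ k, T k = translate v (A k) := by
  choose! v hv using h
  obtain ⟨k0⟩ := ‹Nonempty κ›
  obtain ⟨a, ha⟩ := hA0 k0
  have hb : Bornology.IsBounded (Metric.thickening 1 (T k0)) := (hT k0).isBounded.thickening
  obtain ⟨R, hR⟩ := hb.subset_closedBall 0
  have hpos : ∀ m : ℕ, 0 < 1 / ((m : ℝ) + 1) := fun m => Nat.one_div_pos_of_nat
  have hle : ∀ m : ℕ, 1 / ((m : ℝ) + 1) ≤ 1 := fun m => by
    rw [div_le_one (by positivity)]; linarith [(Nat.cast_nonneg m : (0 : ℝ) ≤ m)]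
  -- Each of these shifts carries the fixed point `a` into the `1`-neighbourhood of `T k0`, so they
  -- stay bounded and have a convergent subsequence.
  have hmem : ∀ m : ℕ, v (1 / ((m : ℝ) + 1)) ∈ Metric.closedBall (0 : E d) (R + ‖a‖) := fun m => by
    have h1 : v (1 / ((m : ℝ) + 1)) + a ∈ Metric.closedBall (0 : E d) R :=
      hR (Metric.thickening_mono (hle m) _ ((hv _ (hpos m) k0).2 ⟨a, ha, rfl⟩))
    rw [mem_closedBall_zero_iff] at h1 ⊢
    have := norm_sub_le (v (1 / ((m : ℝ) + 1)) + a) a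
    rw [add_sub_cancel_right] at this
    linarith
  obtain ⟨w, -, φ, hφ, hlim⟩ := (isCompact_closedBall (0 : E d) (R + ‖a‖)).tendsto_subseq hmem
  refine ⟨w, fun k => eq_of_forall_close (hT k).isClosed
    (isClosed_translate (hA k).isClosed w) fun δ hδ => ?_⟩
  have e1 := (Metric.tendsto_atTop.1 hlim) (δ / 2) (by positivity)
  have e2 := (Metric.tendsto_atTop.1 ((tendsto_one_div_add_atTop_nhds_zero_nat (𝕜 := ℝ)).comp hφ.tendsto_atTop))
    (δ / 2) (by positivity)
  obtain ⟨N1, hN1⟩ := e1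
  obtain ⟨N2, hN2⟩ := e2
  have h1 := hN1 (max N1 N2) (le_max_left _ _)
  have h2 := hN2 (max N1 N2) (le_max_right _ _)
  simp only [Function.comp, Real.dist_eq, sub_zero] at h2
  have h3 := ((hv _ (hpos (φ (max N1 N2))) k).mono ((le_abs_self _).trans h2.le)).trans
    (close_translate (A k) h1)
  rwa [add_halves] at h3

end CfDist

/-! ### Finite choices -/

/-- A choice from a finite set that is possible with every precision can be made independently of
the precision. -/
theorem exists_forall_pos_of_finite {κ : Type*} [Finite κ] (p : ℝ → κ → Prop)
    (hmono : ∀ δ δ' k, δ ≤ δ' → p δ k → p δ' k) (h : ∀ δ > 0, ∃ k, p δ k) :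
    ∃ k, ∀ δ > 0, p δ k := by
  by_contra! hc
  choose δ hδ hp using hc
  have hne : Nonempty κ := ⟨(h 1 one_pos).choose⟩
  obtain ⟨k0, hk0⟩ := Finite.exists_min δ
  obtain ⟨k, hk⟩ := h (δ k0) (hδ k0)
  exact hp k (hmono _ _ _ (hk0 k) hk)

/-- The pigeonhole principle along an ultrafilter; it replaces repeated passage to subsequences. -/
theorem exists_eventually_of_finite {X κ : Type*} [Finite κ] (U : Ultrafilter X)
    (p : X → κ → Prop) (h : ∀ᶠ x in U, ∃ k, p x k) : ∃ k, ∀ᶠ x in U, p x k := by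
  by_contra! hc
  have h1 : ∀ k, ∀ᶠ x in U, ¬ p x k := hc
  obtain ⟨x, ⟨k, hk⟩, hx⟩ := (h.and (Filter.eventually_all.2 h1)).exists
  exact hx k hk

namespace SubstitutionRule

/-! ### Iterated substitution -/

section Iter

variable {d : ℕ} {Γ : Subgroup (E d ≃ₗᵢ[ℝ] E d)} (ρ : SubstitutionRule d Γ)

/-- `ρ.Iter m c c'`: substituting `m` times, starting from the copy `c`, yields a patch that
contains the copy `c'`. -/
inductive Iter : ℕ → Copy d ρ.n → Copy d ρ.n → Prop
  | refl (c : Copy d ρ.n) : Iter 0 c c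
  | step (m : ℕ) (c c' : Copy d ρ.n) (e : Fin (ρ.num c'.label)) :
      Iter m c c' → Iter (m + 1) c (ρ.sub c' e)

variable {ρ}

theorem sub_act {k : ℕ} (a : Copy d k) (c : Copy d ρ.n) (e : Fin (ρ.num c.label)) :
    ρ.sub (a.act c) e = a.act (ρ.sub c e) := Copy.act_assoc a c (ρ.piece c.label e)

theorem Iter.trans {a b : ℕ} {c c' c'' : Copy d ρ.n} (h : ρ.Iter a c c') (h' : ρ.Iter b c' c'') :
    ρ.Iter (a + b) c c'' := by
  induction h' with
  | refl => exact h
  | step m c1 c2 e _ ih => exact .step _ _ _ e (ih h)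

theorem Iter.split {a b : ℕ} {c c'' : Copy d ρ.n} (h : ρ.Iter (a + b) c c'') :
    ∃ c', ρ.Iter a c c' ∧ ρ.Iter b c' c'' := by
  induction b generalizing c'' with
  | zero => exact ⟨c'', h, .refl _⟩
  | succ b ih =>
    cases h with
    | step _ _ c1 e h1 =>
      obtain ⟨c', h2, h3⟩ := ih h1
      exact ⟨c', h2, .step _ _ _ e h3⟩

theorem Iter.act {k m : ℕ} (a : Copy d k) {c c' : Copy d ρ.n} (h : ρ.Iter m c c') :
    ρ.Iter m (a.act c) (a.act c') := by
  induction h with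
  | refl c => exact .refl _
  | step m c c' e _ ih =>
    rw [← sub_act]
    exact .step m _ (a.act c') e ih

theorem Iter.of_act {k m : ℕ} (a : Copy d k) {c x : Copy d ρ.n} (h : ρ.Iter m (a.act c) x) :
    ∃ y, x = a.act y ∧ ρ.Iter m c y := by
  induction m generalizing x with
  | zero =>
    cases h
    exact ⟨c, rfl, .refl c⟩
  | succ m ih =>
    cases h with
    | step _ _ c1 e h1 =>
      obtain ⟨y, rfl, hy⟩ := ih h1
      exact ⟨ρ.sub y e, sub_act a y e, .step _ _ y e hy⟩

theorem finite_iter (m : ℕ) (c : Copy d ρ.n) : {c' | ρ.Iter m c c'}.Finite := by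
  induction m with
  | zero =>
    refine (Set.finite_singleton c).subset ?_
    rintro c' h
    cases h
    rfl
  | succ m ih =>
    refine (ih.biUnion fun c' _ => Set.finite_range (ρ.sub c')).subset ?_
    rintro c'' h
    cases h with
    | step _ _ c' e h1 => exact Set.mem_biUnion h1 ⟨e, rfl⟩

theorem Iter.scale_pos {m : ℕ} {c c' : Copy d ρ.n} (h : ρ.Iter m c c') (hc : 0 < c.scale) :
    0 < c'.scale := by
  induction h with
  | refl => exact hc
  | step m c c' e _ ih => exact ρ.sub_scale_pos _ (ih hc) e

theorem Iter.rot_mem {m : ℕ} {c c' : Copy d ρ.n} (h : ρ.Iter m c c') (hc : c.rot ∈ Γ) :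
    c'.rot ∈ Γ := by
  induction h with
  | refl => exact hc
  | step m c c' e _ ih => exact Γ.mul_mem (ih hc) (ρ.rot_mem _ e)

theorem Iter.scale_eq {ξ : ℝ} (hρ : ρ.IsFixedScale ξ) {m : ℕ} {c c' : Copy d ρ.n}
    (h : ρ.Iter m c c') : c'.scale * ξ ^ m = c.scale := by
  have : ξ ≠ 0 := (zero_lt_one.trans hρ.one_lt).ne'
  induction h with
  | refl => simp
  | step m c c' e _ ih =>
    rw [← ih, sub, hρ.scale_eq, pow_succ]
    field_simp

/-- Two lines of descent that differ branch somewhere into different pieces of one tile, whose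
interiors are disjoint. -/
theorem Iter.eq_or_disjoint {m : ℕ} {c c₁ c₂ : Copy d ρ.n} (hc : 0 < c.scale)
    (h₁ : ρ.Iter m c c₁) (h₂ : ρ.Iter m c c₂) :
    c₁ = c₂ ∨ Disjoint (interior (c₁.support ρ.tile)) (interior (c₂.support ρ.tile)) := by
  induction m generalizing c₁ c₂ with
  | zero => cases h₁; cases h₂; exact Or.inl rfl
  | succ m ih =>
    cases h₁ with
    | step _ _ a e h₁ =>
    cases h₂ with
    | step _ _ b e' h₂ =>
    rcases ih h₁ h₂ with rfl | h
    · rcases eq_or_ne e e' with rfl | he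
      · exact Or.inl rfl
      · exact Or.inr (ρ.disjoint_interior_sub _ (h₁.scale_pos hc) he)
    · exact Or.inr (h.mono (interior_mono (ρ.support_sub_subset _ _))
        (interior_mono (ρ.support_sub_subset _ _)))

/-- Substitution commutes with similarities, so all inflations can be carried out before the
substitutions. -/
theorem mem_iterate_inflateSub {ξ : ℝ} {m : ℕ} {j : Fin ρ.n} {c : Copy d ρ.n} :
    c ∈ (ρ.inflateSub ξ)^[m] {Copy.root j 1} ↔ ρ.Iter m (Copy.root j (ξ ^ m)) c := by
  induction m generalizing c with
  | zero =>
    simp only [Function.iterate_zero, id, Set.mem_singleton_iff, pow_zero]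
    constructor
    · rintro rfl; exact .refl _
    · intro h; cases h; rfl
  | succ m ih =>
    have key : Copy.root j (ξ ^ (m + 1)) = (Copy.root (d := d) j ξ).act (Copy.root j (ξ ^ m)) := by
      rw [← Copy.inflate_eq_act]
      simp [Copy.inflate, Copy.root, pow_succ']
    rw [Function.iterate_succ_apply']
    constructor
    · rintro ⟨c1, h1, e, rfl⟩
      rw [key, Copy.inflate_eq_act j]
      exact (Iter.step _ _ _ e (ih.1 h1)).act _
    · intro h
      rw [key] at h
      obtain ⟨y, rfl, hy⟩ := h.of_act
      cases hy with
      | step _ _ c1 e h1 => exact ⟨c1, ih.2 h1, e, (Copy.inflate_eq_act j ξ _).symm⟩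

/-- The labelled patch `(ξρ)^m(Tⱼ)`. -/
def labelledPatch (ρ : SubstitutionRule d Γ) (ξ : ℝ) (m : ℕ) (j : Fin ρ.n) :
    Set (Fin ρ.n × Set (E d)) :=
  (fun c => (c.label, c.support ρ.tile)) '' {c | ρ.Iter m (Copy.root j (ξ ^ m)) c}

theorem generatingLabelledPatches_eq (ξ : ℝ) :
    ρ.generatingLabelledPatches ξ = {P | ∃ m j, P = ρ.labelledPatch ξ m j} := by
  have : ∀ m j, (ρ.inflateSub ξ)^[m] {Copy.root j 1} = {c | ρ.Iter m (Copy.root j (ξ ^ m)) c} :=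
    fun m j => Set.ext fun c => mem_iterate_inflateSub
  simp only [generatingLabelledPatches, labelledPatch, this]

end Iter

/-! ### Powers of the substitution matrix -/

section Matrix

variable {d : ℕ} {Γ : Subgroup (E d ≃ₗᵢ[ℝ] E d)} {ρ : SubstitutionRule d Γ}

theorem matrix_nonneg (i j : Fin ρ.n) : 0 ≤ ρ.matrix i j := by simp [matrix]

theorem matrix_pow_nonneg (k : ℕ) (i j : Fin ρ.n) : 0 ≤ (ρ.matrix ^ k) i j := by
  induction k generalizing i j with
  | zero =>
    rw [pow_zero, Matrix.one_apply]
    split_ifs <;> simp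
  | succ k ih =>
    rw [pow_succ, Matrix.mul_apply]
    exact Finset.sum_nonneg fun l _ => mul_nonneg (ih _ _) (matrix_nonneg _ _)

theorem matrix_pos_iff {i j : Fin ρ.n} : 0 < ρ.matrix i j ↔ ∃ e, (ρ.piece j e).label = i := by
  simp only [matrix, Matrix.of_apply, Nat.cast_pos, Fintype.card_pos_iff, nonempty_subtype]

theorem Iter.matrix_pow_pos {k : ℕ} {c c' : Copy d ρ.n} (h : ρ.Iter k c c') :
    0 < (ρ.matrix ^ k) c'.label c.label := by
  induction h with
  | refl => simp
  | step m c c' e _ ih =>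
    rw [pow_succ', Matrix.mul_apply]
    exact Finset.sum_pos' (fun l _ => mul_nonneg (matrix_nonneg _ _) (matrix_pow_nonneg _ _ _))
      ⟨c'.label, Finset.mem_univ _, mul_pos (matrix_pos_iff.2 ⟨e, rfl⟩) ih⟩

theorem exists_iter_of_matrix_pow_pos {k : ℕ} {i j : Fin ρ.n} (h : 0 < (ρ.matrix ^ k) i j)
    (c : Copy d ρ.n) (hc : c.label = j) : ∃ c', ρ.Iter k c c' ∧ c'.label = i := by
  induction k generalizing j c with
  | zero =>
    rw [pow_zero, Matrix.one_apply] at h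
    have hij : i = j := by by_contra hne; simp [hne] at h
    exact ⟨c, .refl c, hc.trans hij.symm⟩
  | succ k ih =>
    rw [pow_succ, Matrix.mul_apply] at h
    obtain ⟨l, -, hl⟩ := Finset.exists_ne_zero_of_sum_ne_zero h.ne'
    have h1 : 0 < (ρ.matrix ^ k) i l :=
      (matrix_pow_nonneg _ _ _).lt_of_ne' (left_ne_zero_of_mul hl)
    have h2 : 0 < ρ.matrix l j := (matrix_nonneg _ _).lt_of_ne' (right_ne_zero_of_mul hl)
    subst hc
    obtain ⟨e, he⟩ := matrix_pos_iff.1 h2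
    obtain ⟨c', h3, h4⟩ := ih h1 (ρ.sub c e) he
    have h5 := (Iter.step 0 c c e (.refl c)).trans h3
    rw [zero_add, add_comm] at h5
    exact ⟨c', h5, h4⟩

end Matrix

end SubstitutionRule

/-! ### Tilings are infinite -/

/-- A finite tiling would make the whole space compact; in dimension zero it is. Infinitude forces
approximating patches to be large. -/
theorem IsTiling.infinite {d : ℕ} (hd : 0 < d) {𝒯 : Set (Set (E d))} (h : IsTiling 𝒯) :
    𝒯.Infinite := by
  intro hfin
  have : Nonempty (Fin d) := ⟨⟨0, hd⟩⟩
  have hc : IsCompact (⋃₀ 𝒯) := hfin.isCompact_sUnion fun T hT => (h.isTile T hT).isCompact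
  rw [h.union_eq] at hc
  exact noncompact_univ (E d) hc

namespace SubstitutionRule

variable {d : ℕ}

/-! ### Exactness of patches under finite local complexity -/

section Translational

variable {ρ : SubstitutionRule d (⊥ : Subgroup (E d ≃ₗᵢ[ℝ] E d))} {ξ : ℝ}

theorem finite_labelledPatch (ρ : SubstitutionRule d (⊥ : Subgroup (E d ≃ₗᵢ[ℝ] E d))) (ξ : ℝ)
    (m : ℕ) (j : Fin ρ.n) : (ρ.labelledPatch ξ m j).Finite := (finite_iter _ _).image _

/-- Without rotations a tile is determined by label, scale and shift, and the depth determines the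
scale. The auxiliary copy only encodes a translation; its label is immaterial. -/
theorem Iter.eq_act_root (hρ : ρ.IsFixedScale ξ) {a b : ℕ} {j : Fin ρ.n} {c : Copy d ρ.n}
    (h : ρ.Iter a (Copy.root j (ξ ^ (a + b))) c) :
    c = ({ label := j, scale := 1, rot := 1, shift := c.shift } : Copy d ρ.n).act
      (Copy.root c.label (ξ ^ b)) := by
  have h0 : ξ ^ a ≠ 0 := pow_ne_zero _ (zero_lt_one.trans hρ.one_lt).ne'
  have h1 : c.scale = ξ ^ b := by
    have := h.scale_eq hρ
    rw [Copy.root, pow_add, mul_comm] at this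
    exact mul_left_cancel₀ h0 this
  have h2 : c.rot = 1 := Subgroup.mem_bot.1 (h.rot_mem (Subgroup.one_mem _))
  cases c
  subst h1 h2
  simp only [Copy.act, Copy.root, Copy.mk.injEq, true_and, one_mul, smul_zero, map_zero, add_zero]
  exact ⟨rfl, trivial⟩

theorem support_translate_act (j : Fin ρ.n) (v : E d) (c : Copy d ρ.n) :
    (({ label := j, scale := 1, rot := 1, shift := v } : Copy d ρ.n).act c).support ρ.tile =
      translate v (c.support ρ.tile) := by
  rw [Copy.support_act]
  exact Set.image_congr fun x _ => by simp [Copy.place]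

theorem exists_eq_translate_of_mem_labelledPatch (hρ : ρ.IsFixedScale ξ) {m : ℕ} {j : Fin ρ.n}
    {p : Fin ρ.n × Set (E d)} (hp : p ∈ ρ.labelledPatch ξ m j) :
    ∃ v, p.2 = translate v (ρ.tile p.1) := by
  obtain ⟨c, hc, rfl⟩ := hp
  have h := Iter.eq_act_root (b := 0) hρ hc
  refine ⟨c.shift, (congrArg (Copy.support ρ.tile) h).trans ?_⟩
  rw [support_translate_act]
  simp [Copy.support, Copy.root]

theorem eq_of_mem_labelledPatch (hρ : ρ.IsFixedScale ξ) {m : ℕ} {j : Fin ρ.n}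
    {p q : Fin ρ.n × Set (E d)} (hp : p ∈ ρ.labelledPatch ξ m j)
    (hq : q ∈ ρ.labelledPatch ξ m j) (h : ¬ Disjoint (interior p.2) (interior q.2)) : p = q := by
  obtain ⟨c, hc, rfl⟩ := hp
  obtain ⟨c', hc', rfl⟩ := hq
  have hpos : 0 < ξ := zero_lt_one.trans hρ.one_lt
  rcases Iter.eq_or_disjoint (by simpa [Copy.root] using pow_pos hpos m) hc hc' with rfl | h'
  · rfl
  · exact absurd h' h

/-- Every tile of a generating patch lies in a translate of a generating patch of prescribed
smaller level. -/
theorem exists_subpatch_of_mem_labelledPatch (hρ : ρ.IsFixedScale ξ) {a b : ℕ} {j : Fin ρ.n}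
    {p : Fin ρ.n × Set (E d)} (hp : p ∈ ρ.labelledPatch ξ (a + b) j) :
    ∃ J v, (∀ q ∈ ρ.labelledPatch ξ b J, (q.1, translate v q.2) ∈ ρ.labelledPatch ξ (a + b) j) ∧
      ∃ q ∈ ρ.labelledPatch ξ b J, p.2 = translate v q.2 := by
  obtain ⟨c, hc, rfl⟩ := hp
  obtain ⟨C, h1, h2⟩ := Iter.split hc
  have h3 := Iter.eq_act_root hρ h1
  refine ⟨C.label, C.shift, ?_, ?_⟩
  · rintro _ ⟨c', hc', rfl⟩
    refine ⟨({ label := j, scale := 1, rot := 1, shift := C.shift } : Copy d ρ.n).act c', ?_, ?_⟩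
    · refine h1.trans ?_
      have := hc'.act ({ label := j, scale := 1, rot := 1, shift := C.shift } : Copy d ρ.n)
      rwa [← h3] at this
    · exact Prod.ext rfl (support_translate_act _ _ _)
  · rw [h3] at h2
    obtain ⟨y, rfl, hy⟩ := h2.of_act
    exact ⟨_, ⟨y, hy, rfl⟩, support_translate_act _ _ _⟩

/-- In the primitive case every generating patch is, up to translation, contained in all generating
patches of a suitable higher level. -/
theorem exists_translate_labelledPatch_subset (hρ : ρ.IsFixedScale ξ) (hprim : ρ.IsPrimitive) :
    ∃ k, ∀ b J j, ∃ v, ∀ q ∈ ρ.labelledPatch ξ b j,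
      (q.1, translate v q.2) ∈ ρ.labelledPatch ξ (k + b) J := by
  obtain ⟨k, -, hk⟩ := hprim.exists_pos_pow
  refine ⟨k, fun b J j => ?_⟩
  obtain ⟨C, h1, rfl⟩ := exists_iter_of_matrix_pow_pos (hk j J) (Copy.root J (ξ ^ (k + b))) rfl
  have h3 := Iter.eq_act_root hρ h1
  refine ⟨C.shift, ?_⟩
  rintro _ ⟨c', hc', rfl⟩
  refine ⟨({ label := J, scale := 1, rot := 1, shift := C.shift } : Copy d ρ.n).act c', ?_, ?_⟩
  · refine h1.trans ?_
    have := hc'.act ({ label := J, scale := 1, rot := 1, shift := C.shift } : Copy d ρ.n)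
    rwa [← h3] at this
  · exact Prod.ext rfl (support_translate_act _ _ _)

theorem exists_ball_subset_tile (ρ : SubstitutionRule d (⊥ : Subgroup (E d ≃ₗᵢ[ℝ] E d))) :
    ∃ r > 0, ∀ j, ∃ y, Metric.ball y r ⊆ ρ.tile j := by
  have h : ∀ j, ∃ r > 0, ∃ y, Metric.ball y r ⊆ ρ.tile j := fun j => by
    obtain ⟨y, hy⟩ := (ρ.isTile j).interior_nonempty
    obtain ⟨r, hr, hb⟩ := Metric.isOpen_iff.1 isOpen_interior y hy
    exact ⟨r, hr, y, hb.trans interior_subset⟩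
  choose r hr y hy using h
  rcases isEmpty_or_nonempty (Fin ρ.n) with he | hne
  · exact ⟨1, one_pos, fun j => he.elim j⟩
  · obtain ⟨j0, hj0⟩ := Finite.exists_min r
    exact ⟨r j0, hr j0, fun j => ⟨y j, (Metric.ball_subset_ball (hj0 j)).trans (hy j)⟩⟩

theorem exists_dist_le_of_mem_labelledPatch (hρ : ρ.IsFixedScale ξ) :
    ∃ D, ∀ m j, ∀ p ∈ ρ.labelledPatch ξ m j, ∀ v, ∀ x ∈ translate v p.2, ∀ y ∈ translate v p.2,
      dist x y ≤ D := by
  have h : Bornology.IsBounded (⋃ j, ρ.tile j) :=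
    (Bornology.isBounded_iUnion).2 fun j => (ρ.isTile j).isCompact.isBounded
  obtain ⟨D, hD⟩ := Metric.isBounded_iff.1 h
  refine ⟨D, ?_⟩
  rintro m j p hp v _ ⟨x, hx, rfl⟩ _ ⟨y, hy, rfl⟩
  obtain ⟨w, hw⟩ := exists_eq_translate_of_mem_labelledPatch hρ hp
  rw [hw] at hx hy
  obtain ⟨x, hx, rfl⟩ := hx
  obtain ⟨y, hy, rfl⟩ := hy
  simpa using hD (Set.mem_iUnion.2 ⟨_, hx⟩) (Set.mem_iUnion.2 ⟨_, hy⟩)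

/-- The Hausdorff form of the approximation of patches by generating patches. -/
theorem exists_close_labelledPatch (hρ : ρ.IsFixedScale ξ) {𝒯 : Set (Fin ρ.n × Set (E d))}
    (h𝒯 : IsSubstitutionTiling ρ ξ 𝒯) {P : Set (Fin ρ.n × Set (E d))} (hP : P ⊆ 𝒯)
    (hfin : P.Finite) {δ : ℝ} (hδ : 0 < δ) :
    ∃ m j v f, Set.InjOn f P ∧ Set.MapsTo f P (ρ.labelledPatch ξ m j) ∧
      ∀ p ∈ P, (f p).1 = p.1 ∧ Close δ p.2 (translate v (f p).2) := by
  obtain ⟨D, hD⟩ := exists_dist_le_of_mem_labelledPatch hρ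
  have htile : ∀ p ∈ 𝒯, IsTile p.2 := fun p hp => h𝒯.isTiling.1.isTile _ ⟨p, hp, rfl⟩
  have h1 : ∀ p : P, ∃ ε > 0, ∀ A : Set (E d), (∀ x ∈ A, ∀ y ∈ A, dist x y ≤ D) →
      cfDist p.1.2 A < ε → Close δ p.1.2 A := fun p =>
    exists_close_of_cfDist_lt (htile _ (hP p.2)).isCompact.isBounded (htile _ (hP p.2)).nonempty
      D hδ
  choose ε hε hclose using h1
  have hPf : Finite P := hfin
  obtain ⟨ε0, hε0, hmin⟩ : ∃ ε0 > 0, ∀ p, ε0 ≤ ε p := by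
    rcases isEmpty_or_nonempty P with he | hne
    · exact ⟨1, one_pos, fun p => he.elim p⟩
    · obtain ⟨p0, hp0⟩ := Finite.exists_min ε
      exact ⟨ε p0, hε p0, hp0⟩
  obtain ⟨G, hG, v, f, hinj, hmaps, hf⟩ := h𝒯.isLimit P hP hfin ε0 hε0
  rw [generatingLabelledPatches_eq] at hG
  obtain ⟨m, j, rfl⟩ := hG
  exact ⟨m, j, v, f, hinj, hmaps, fun p hp => ⟨(hf p hp).1,
    hclose ⟨p, hp⟩ _ (hD m j _ (hmaps hp) v) ((hf p hp).2.trans_le (hmin _))⟩⟩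

theorem isTile_of_mem_labelledPatch (hρ : ρ.IsFixedScale ξ) {m : ℕ} {j : Fin ρ.n}
    {p : Fin ρ.n × Set (E d)} (hp : p ∈ ρ.labelledPatch ξ m j) : IsTile p.2 := by
  obtain ⟨c, hc, rfl⟩ := hp
  have hpos : 0 < ξ := zero_lt_one.trans hρ.one_lt
  exact ρ.isTile_support c (Iter.scale_pos hc (by simpa [Copy.root] using pow_pos hpos m))

theorem interior_translate (v : E d) (A : Set (E d)) :
    interior (translate v A) = translate v (interior A) :=
  ((Homeomorph.addLeft v).image_interior A).symm

/-- Generating patches of every level occur exactly, up to translation, in a substitution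
tiling. -/
theorem exists_labelledPatch_subset_tiling (hd : 0 < d) (hρ : ρ.IsFixedScale ξ)
    {𝒯 : Set (Fin ρ.n × Set (E d))} (h𝒯 : IsSubstitutionTiling ρ ξ 𝒯) (s : ℕ) :
    ∃ J w, ∀ q ∈ ρ.labelledPatch ξ s J, translate w q.2 ∈ forgetLabels 𝒯 := by
  obtain ⟨r, hr, hball⟩ := exists_ball_subset_tile ρ
  have hbdd : Bornology.IsBounded (⋃ J, ⋃ q ∈ ρ.labelledPatch ξ s J, q.2) :=
    Bornology.isBounded_iUnion.2 fun J =>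
      (Bornology.isBounded_biUnion (finite_labelledPatch ρ ξ s J)).2 fun q hq =>
        (isTile_of_mem_labelledPatch hρ hq).isCompact.isBounded
  obtain ⟨D, hD⟩ := hbdd.subset_closedBall 0
  have hD' : ∀ J, ∀ q ∈ ρ.labelledPatch ξ s J, ∀ x ∈ q.2, ‖x‖ ≤ D := fun J q hq x hx => by
    simpa using hD (Set.mem_iUnion.2 ⟨J, Set.mem_biUnion hq hx⟩)
  have hcov : ∀ z : E d, ∃ p ∈ 𝒯, z ∈ p.2 := fun z => by
    have hz : z ∈ ⋃₀ forgetLabels 𝒯 := by rw [h𝒯.isTiling.1.union_eq]; trivial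
    obtain ⟨_, ⟨p, hp, rfl⟩, hz⟩ := hz
    exact ⟨p, hp, hz⟩
  choose τ hτ hτz using hcov
  -- The shift found below has norm at most `D + 1` and points of level `s` patches have norm at
  -- most `D`, so the shifted patch lies within `2 * D + 1` of the origin.
  obtain ⟨t, -, htfin, htcov⟩ := (isCompact_closedBall (0 : E d) (2 * D + 1)).finite_cover_balls (half_pos hr)
  -- `H` collects all tiles of levels below `s`. Including more than `H.ncard` tiles in `P` forces
  -- any generating patch approximating `P` to have level at least `s`.
  set H : Set (Fin ρ.n × Set (E d)) := ⋃ m : Fin s, ⋃ j, ρ.labelledPatch ξ m j with hH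
  have hHfin : H.Finite := Set.finite_iUnion fun m => Set.finite_iUnion fun j =>
    finite_labelledPatch ρ ξ m j
  have hinf : 𝒯.Infinite := Set.Infinite.of_image Prod.snd (h𝒯.isTiling.1.infinite hd)
  obtain ⟨B, hB, hBfin, hBcard⟩ := hinf.exists_subset_ncard_eq (H.ncard + 1)
  set P : Set (Fin ρ.n × Set (E d)) := insert (τ 0) (τ '' t ∪ B) with hP
  have hPfin : P.Finite := ((htfin.image _).union hBfin).insert _
  have hP𝒯 : P ⊆ 𝒯 := by
    rintro p (rfl | ⟨z, -, rfl⟩ | hp)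
    · exact hτ 0
    · exact hτ z
    · exact hB hp
  have hfP : Finite P := hPfin
  have hfL : ∀ J, Finite (ρ.labelledPatch ξ s J) := fun J => finite_labelledPatch ρ ξ s J
  obtain ⟨⟨J, g⟩, hg⟩ := exists_forall_pos_of_finite
    (κ := Σ J, (ρ.labelledPatch ξ s J → P))
    (fun δ k => ∃ w, ∀ q, Close δ (k.2 q).1.2 (translate w q.1.2))
    (fun δ δ' k hle ⟨w, hw⟩ => ⟨w, fun q => (hw q).mono hle⟩) (by
      intro δ hδ
      obtain ⟨m, j, v, f, hinj, hmaps, hf⟩ := exists_close_labelledPatch hρ h𝒯 hP𝒯 hPfin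
        (δ := min δ (min 1 (r / 2))) (by positivity)
      have hsm : s ≤ m := by
        by_contra! hlt
        have hBP : B ⊆ P := fun p hp => Or.inr (Or.inr hp)
        have := Set.ncard_le_ncard_of_injOn f (s := B) (t := H)
          (fun p hp => Set.mem_iUnion.2 ⟨⟨m, hlt⟩, Set.mem_iUnion.2 ⟨j, hmaps (hBP hp)⟩⟩)
          (hinj.mono hBP) hHfin
        omega
      obtain ⟨a, rfl⟩ := Nat.exists_eq_add_of_le' hsm
      have h0P : τ 0 ∈ P := Or.inl rfl
      obtain ⟨J, v₁, hsub, q₀, hq₀, hfq₀⟩ := exists_subpatch_of_mem_labelledPatch hρ (hmaps h0P)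
      have hw : ‖v + v₁‖ ≤ D + 1 := by
        obtain ⟨b, hb, hdist⟩ := Metric.mem_thickening_iff.1 ((hf _ h0P).2.1 (hτz 0))
        rw [hfq₀, translate_translate] at hb
        obtain ⟨x, hx, rfl⟩ := hb
        have h1 := hD' J q₀ hq₀ x hx
        rw [dist_zero_left] at hdist
        have h2 := hdist.trans_le ((min_le_right _ _).trans (min_le_left _ _))
        have h3 := norm_sub_le (v + v₁ + x) x
        rw [add_sub_cancel_right] at h3
        linarith
      -- Each tile of the shifted level `s` patch contains a ball of radius `r`. A net point `z`
      -- lies within `r / 2` of its centre, and the approximant of the tile `τ z` has a point within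
      -- `r / 2` of `z`. The two tiles overlap inside one generating patch, so they coincide.
      have key : ∀ q : ρ.labelledPatch ξ s J, ∃ p : P, f p.1 = (q.1.1, translate v₁ q.1.2) := by
        rintro ⟨q, hq⟩
        have hU := hsub q hq
        obtain ⟨v₂, hv₂⟩ := exists_eq_translate_of_mem_labelledPatch hρ hq
        obtain ⟨y, hy⟩ := hball q.1
        have hsubset : Metric.ball (v + v₁ + (v₂ + y)) r ⊆ translate v (translate v₁ q.2) := by
          intro x hx
          rw [translate_translate, hv₂, translate_translate]
          refine ⟨x - (v + v₁ + v₂), hy ?_, by simp⟩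
          rw [Metric.mem_ball, dist_eq_norm] at hx ⊢
          convert hx using 2
          abel
        have hyq : v₂ + y ∈ q.2 := by
          rw [hv₂]; exact ⟨y, hy (Metric.mem_ball_self hr), rfl⟩
        have hz0 : v + v₁ + (v₂ + y) ∈ Metric.closedBall (0 : E d) (2 * D + 1) := by
          rw [mem_closedBall_zero_iff]
          have := norm_add_le (v + v₁) (v₂ + y)
          have := hD' J q hq _ hyq
          linarith
        obtain ⟨z, hz, hzz⟩ := Set.mem_iUnion₂.1 (htcov hz0)
        have hpP : τ z ∈ P := Or.inr (Or.inl ⟨z, hz, rfl⟩)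
        refine ⟨⟨τ z, hpP⟩, eq_of_mem_labelledPatch hρ (hmaps hpP) hU ?_⟩
        obtain ⟨b, hb, hdist⟩ := Metric.mem_thickening_iff.1 ((hf _ hpP).2.1 (hτz z))
        have hbz : b ∈ Metric.ball (v + v₁ + (v₂ + y)) r := by
          rw [Metric.mem_ball] at hzz ⊢
          have h1 := hdist.trans_le ((min_le_right _ _).trans (min_le_right _ _))
          rw [dist_comm] at h1
          rw [dist_comm] at hzz
          have h3 := dist_triangle b z (v + v₁ + (v₂ + y))
          linarith
        obtain ⟨b', hb', rfl⟩ := hb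
        -- The point found may lie on the boundary; an interior point of the same tile lies in the
        -- same open ball.
        rw [← (isTile_of_mem_labelledPatch hρ (hmaps hpP)).closure_interior] at hb'
        have hopen : IsOpen ((fun x => v + x) ⁻¹' Metric.ball (v + v₁ + (v₂ + y)) r) :=
          Metric.isOpen_ball.preimage (by fun_prop)
        obtain ⟨x, hx1, hx2⟩ := mem_closure_iff.1 hb' _ hopen hbz
        refine Set.not_disjoint_iff.2 ⟨x, hx2, ?_⟩
        have hx3 := interior_mono hsubset (by rwa [Metric.isOpen_ball.interior_eq])
        rw [interior_translate] at hx3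
        obtain ⟨x', hx', hxx⟩ := hx3
        obtain rfl : x' = x := add_right_injective v hxx
        exact hx'
      choose g hg using key
      refine ⟨⟨J, g⟩, v + v₁, fun q => ?_⟩
      have h1 := (hf _ (g q).2).2
      rw [hg q, translate_translate] at h1
      exact h1.mono (min_le_left _ _))
  rcases isEmpty_or_nonempty (ρ.labelledPatch ξ s J) with he | hne
  · exact ⟨J, 0, fun q hq => he.elim ⟨q, hq⟩⟩
  obtain ⟨w, hw⟩ := exists_eq_translate_of_close (fun q => (g q).1.2) (fun q => q.1.2)
    (fun q => (h𝒯.isTiling.1.isTile _ ⟨_, hP𝒯 (g q).2, rfl⟩).isCompact)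
    (fun q => (isTile_of_mem_labelledPatch hρ q.2).isCompact)
    (fun q => (isTile_of_mem_labelledPatch hρ q.2).nonempty) hg
  refine ⟨J, w, fun q hq => ?_⟩
  rw [← hw ⟨q, hq⟩]
  exact ⟨_, hP𝒯 (g ⟨q, hq⟩).2, rfl⟩

/-- In a primitive substitution tiling of finite local complexity, without rotations, all patches
are exactly legal. -/
theorem isTranslatedLabelledSubpatch_of_finiteLocalComplexity (hd : 0 < d)
    (hρ : ρ.IsFixedScale ξ) (hprim : ρ.IsPrimitive) {𝒯 : Set (Fin ρ.n × Set (E d))}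
    (h𝒯 : IsSubstitutionTiling ρ ξ 𝒯) (hflc : HasFiniteLocalComplexity (forgetLabels 𝒯))
    {P : Set (Fin ρ.n × Set (E d))} (hP : P ⊆ 𝒯) (hfin : P.Finite) :
    IsTranslatedLabelledSubpatch (ρ.generatingLabelledPatches ξ) P := by
  rcases P.eq_empty_or_nonempty with rfl | hne
  · obtain ⟨G, hG, -⟩ := h𝒯.isLimit ∅ hP hfin 1 one_pos
    exact ⟨G, hG, 0, Set.empty_subset _⟩
  have hPne : Nonempty P := hne.to_subtype
  have hPf : Finite P := hfin
  obtain ⟨k, hk⟩ := exists_translate_labelledPatch_subset hρ hprim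
  have hbdd : Bornology.IsBounded (⋃ p ∈ P, p.2) := (Bornology.isBounded_biUnion hfin).2
    fun p hp => (h𝒯.isTiling.1.isTile _ ⟨p, hP hp, rfl⟩).isCompact.isBounded
  obtain ⟨R, hR⟩ := hbdd.subset_closedBall 0
  -- Approximants at precision at most one stay in a ball of radius `R + 1`.
  obtain ⟨𝓕, h𝓕, hflc⟩ := hflc (R + 1)
  have hf𝓕 : Finite {F // F ∈ 𝓕 ∧ F.Finite} := (h𝓕.sep fun F => F.Finite)
  have hfF : ∀ F : {F // F ∈ 𝓕 ∧ F.Finite}, Finite F.1 := fun F => F.2.2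
  -- Only the representative `F` and the assignment `τ` must be independent of the precision. The
  -- predicate also records that the tiles, with the labels of `P`, come from some generating patch.
  obtain ⟨⟨F, τ⟩, hτ⟩ := exists_forall_pos_of_finite
    (κ := Σ F : {F // F ∈ 𝓕 ∧ F.Finite}, (P → F.1))
    (fun δ k => ∃ v, (∃ m j, ∃ f : P → Fin ρ.n × Set (E d), ∃ v', ∀ p, f p ∈ ρ.labelledPatch ξ m j ∧ (f p).1 = p.1.1 ∧
      (f p).2 = translate v' (k.2 p).1) ∧ ∀ p, Close δ p.1.2 (translate v (k.2 p).1))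
    (by
      rintro δ δ' k hle ⟨v, h1, h2⟩
      exact ⟨v, h1, fun p => (h2 p).mono hle⟩) (by
      intro δ hδ
      obtain ⟨m, j, v, f, -, hmaps, hf⟩ := exists_close_labelledPatch hρ h𝒯 hP hfin
        (δ := min δ 1) (by positivity)
      -- A level `k + m` patch occurs in the tiling and contains a translate of the level `m` patch
      -- used here, so finite local complexity applies to the approximant.
      obtain ⟨J, w, hJ⟩ := exists_labelledPatch_subset_tiling hd hρ h𝒯 (k + m)
      obtain ⟨v₂, hv₂⟩ := hk m J j
      have hmem : ∀ p ∈ P, translate (w + v₂) (f p).2 ∈ forgetLabels 𝒯 := fun p hp => by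
        rw [← translate_translate]
        exact hJ _ (hv₂ _ (hmaps hp))
      obtain ⟨F, hF, u, hu⟩ := hflc ((fun p => translate (w + v₂) (f p).2) '' P)
        (Set.image_subset_iff.2 hmem) (hfin.image _) (by
          refine ⟨w + v₂ - v, Set.sUnion_subset ?_⟩
          rintro _ ⟨p, hp, rfl⟩ _ ⟨x, hx, rfl⟩
          obtain ⟨b, hb, hdist⟩ := Metric.mem_thickening_iff.1 ((hf p hp).2.2 ⟨x, hx, rfl⟩)
          have h1 := hR (Set.mem_biUnion hp hb)
          have h2 := hdist.trans_le (min_le_right _ _)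
          rw [mem_closedBall_zero_iff] at h1
          rw [dist_eq_norm] at h2
          have h3 := norm_add_le (v + x - b) b
          rw [sub_add_cancel] at h3
          simp only [Metric.mem_closedBall, dist_eq_norm]
          rw [show w + v₂ + x - (w + v₂ - v) = v + x by abel]
          linarith)
      have hFfin : F.Finite := by
        have := hfin.image fun p => translate (w + v₂) (f p).2
        rw [hu] at this
        exact this.of_finite_image (translate_injective u).injOn
      have key : ∀ p : P, ∃ T : F, translate u T.1 = translate (w + v₂) (f p).2 := fun p => by
        have : translate (w + v₂) (f p).2 ∈ translate u '' F := hu ▸ ⟨p.1, p.2, rfl⟩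
        obtain ⟨T, hT, h⟩ := this
        exact ⟨⟨T, hT⟩, h⟩
      choose g hg using key
      have hg' : ∀ p : P, (f p).2 = translate (-(w + v₂) + u) (g p).1 := fun p => by
        rw [← translate_translate, hg p, translate_translate, neg_add_cancel, translate_zero]
      refine ⟨⟨⟨F, hF, hFfin⟩, g⟩, v + (-(w + v₂) + u), ⟨m, j, fun p => f p, -(w + v₂) + u,
        fun p => ⟨hmaps p.2, (hf p p.2).1, hg' p⟩⟩, fun p => ?_⟩
      have h1 := (hf p p.2).2.mono (min_le_left _ _)
      rwa [hg' p, translate_translate] at h1)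
  -- Legality of `τ` is an exact statement, so its instance at any one precision suffices.
  obtain ⟨-, ⟨m, j, f, v', hf⟩, -⟩ := hτ 1 one_pos
  have hτf : ∀ p, (τ p).1 = translate (-v') (f p).2 := fun p => by
    rw [(hf p).2.2, translate_translate, neg_add_cancel, translate_zero]
  have htile := fun p => isTile_of_mem_labelledPatch hρ (hf p).1
  obtain ⟨w, hw⟩ := exists_eq_translate_of_close (fun p : P => p.1.2) (fun p => (τ p).1)
    (fun p => (h𝒯.isTiling.1.isTile _ ⟨_, hP p.2, rfl⟩).isCompact)
    (fun p => by rw [hτf]; exact (htile p).isCompact.image (continuous_const.add continuous_id))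
    (fun p => by rw [hτf]; exact (htile p).nonempty.image _)
    (fun δ hδ => (hτ δ hδ).imp fun _ h => h.2)
  refine ⟨ρ.labelledPatch ξ m j, by rw [generatingLabelledPatches_eq]; exact ⟨m, j, rfl⟩,
    w + -v', fun p hp => ⟨f ⟨p, hp⟩, (hf _).1, Prod.ext (hf _).2.1 ?_⟩⟩
  change translate (w + -v') (f ⟨p, hp⟩).2 = p.2
  rw [← translate_translate, ← hτf, ← hw ⟨p, hp⟩]

end Translational

end SubstitutionRule

namespace SubstitutionRule

variable {d : ℕ} {Γ : Subgroup (E d ≃ₗᵢ[ℝ] E d)}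

/-! ### Integral weights on the associated graph -/

/-- Integral weights for the edges of the associated graph: after rescaling the prototile `Tᵢ` by
`exp (u i)`, all scales are nonpositive integral powers of `exp α`. -/
structure Weighting (σ : SubstitutionRule d Γ) (α : ℝ) where
  pos : 0 < α
  u : Fin σ.n → ℝ
  w : (i : Fin σ.n) → Fin (σ.num i) → ℕ
  scale_eq : ∀ i e, (σ.piece i e).scale = Real.exp (u (σ.piece i e).label - u i - α * w i e)
  scale_lt_one : ∀ i e, (σ.piece i e).scale < 1

namespace Weighting

variable {σ : SubstitutionRule d Γ} {α : ℝ} (W : σ.Weighting α)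

/-- The points dividing the edges of the associated graph into segments of unit weight. -/
abbrev Label : Type := Σ i : Fin σ.n, Σ e : Fin (σ.num i), Fin (W.w i e)

/-- All scales are below one, so an edge of weight zero lowers the potential. There is no cycle of
weight zero, and the number of vertices of smaller potential is a termination measure. -/
theorem u_lt {i : Fin σ.n} {e : Fin (σ.num i)} (h : W.w i e = 0) :
    W.u (σ.piece i e).label < W.u i := by
  have h1 := W.scale_lt_one i e
  rw [W.scale_eq, h, Real.exp_lt_one_iff] at h1
  simp only [Nat.cast_zero, mul_zero, sub_zero] at h1
  linarith

theorem rank_lt {i j : Fin σ.n} (h : W.u j < W.u i) :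
    (Finset.univ.filter fun l => W.u l < W.u j).card <
      (Finset.univ.filter fun l => W.u l < W.u i).card := by
  refine Finset.card_lt_card ⟨fun l hl => ?_, fun hsub => ?_⟩
  · simp only [Finset.mem_filter, Finset.mem_univ, true_and] at hl ⊢
    exact hl.trans h
  · have := hsub (show j ∈ _ by simpa using h)
    simp at this

/-- The tiles obtained from a copy by substituting along edges of weight zero until an edge of
positive weight is traversed; each tile is recorded with the last edge traversed. -/
def expand (c : Copy d σ.n) : List (W.Label × Copy d σ.n) :=
  (List.finRange (σ.num c.label)).flatMap fun e =>
    if h : W.w c.label e = 0 then expand (σ.sub c e)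
    -- The last coordinate of a label counts the units still ahead; the present step uses one of the
    -- `w` units.
    else [(⟨c.label, e, ⟨W.w c.label e - 1, by omega⟩⟩, σ.sub c e)]
termination_by (Finset.univ.filter fun l => W.u l < W.u c.label).card
decreasing_by exact W.rank_lt (W.u_lt h)

theorem induction {p : Copy d σ.n → Prop}
    (h : ∀ c, (∀ e, W.w c.label e = 0 → p (σ.sub c e)) → p c) (c : Copy d σ.n) : p c :=
  h c fun e _ => induction h (σ.sub c e)
termination_by (Finset.univ.filter fun l => W.u l < W.u c.label).card
decreasing_by exact W.rank_lt (W.u_lt ‹_›)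

theorem mem_expand {c : Copy d σ.n} {x : W.Label × Copy d σ.n} :
    x ∈ W.expand c ↔ ∃ e, (W.w c.label e = 0 ∧ x ∈ W.expand (σ.sub c e)) ∨
      ∃ h : W.w c.label e ≠ 0, x = (⟨c.label, e, ⟨W.w c.label e - 1, by omega⟩⟩, σ.sub c e) := by
  rw [expand, List.mem_flatMap]
  refine exists_congr fun e => ?_
  by_cases h : W.w c.label e = 0 <;> simp [h]

theorem expand_sub_subset {c : Copy d σ.n} {e : Fin (σ.num c.label)} (h : W.w c.label e = 0) :
    W.expand (σ.sub c e) ⊆ W.expand c :=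
  fun _ hx => W.mem_expand.2 ⟨e, Or.inl ⟨h, hx⟩⟩

theorem mem_expand_self {c : Copy d σ.n} {e : Fin (σ.num c.label)} (h : W.w c.label e ≠ 0) :
    ((⟨c.label, e, ⟨W.w c.label e - 1, by omega⟩⟩, σ.sub c e) : W.Label × Copy d σ.n) ∈
      W.expand c :=
  W.mem_expand.2 ⟨e, Or.inr ⟨h, rfl⟩⟩

/-- The prototile at which the edge of a label ends. -/
def target (L : W.Label) : Fin σ.n := (σ.piece L.1 L.2.1).label

/-- All edges before the last have weight zero and the potentials telescope, so only the weight of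
the last edge enters the scale. -/
theorem expand_spec (c : Copy d σ.n) : ∀ x ∈ W.expand c,
    x.2.label = W.target x.1 ∧ (x.1.2.2 : ℕ) + 1 = W.w x.1.1 x.1.2.1 ∧
    x.2.scale = c.scale * Real.exp (W.u x.2.label - W.u c.label - α * W.w x.1.1 x.1.2.1) ∧
    (c.rot ∈ Γ → x.2.rot ∈ Γ) := by
  induction c using W.induction with
  | h c ih =>
  intro x hx
  obtain ⟨e, ⟨h, hx⟩ | ⟨h, rfl⟩⟩ := W.mem_expand.1 hx
  · obtain ⟨h1, h2, h3, h4⟩ := ih e h x hx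
    refine ⟨h1, h2, ?_, fun hc => h4 (Γ.mul_mem hc (σ.rot_mem _ e))⟩
    rw [h3, sub, W.scale_eq, h, mul_assoc, ← Real.exp_add]
    congr 2
    push_cast
    ring
  · refine ⟨rfl, ?_, ?_, fun hc => Γ.mul_mem hc (σ.rot_mem _ e)⟩
    · simp only; omega
    · simp only [sub, W.scale_eq]

theorem iUnion_support_expand (c : Copy d σ.n) :
    ⋃ x ∈ W.expand c, x.2.support σ.tile = c.support σ.tile := by
  induction c using W.induction with
  | h c ih =>
  rw [← σ.iUnion_support_sub c]
  ext y
  simp only [Set.mem_iUnion, exists_prop]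
  constructor
  · rintro ⟨x, hx, hy⟩
    obtain ⟨e, ⟨h, hx⟩ | ⟨h, rfl⟩⟩ := W.mem_expand.1 hx
    · exact ⟨e, by rw [← ih e h]; exact Set.mem_biUnion hx hy⟩
    · exact ⟨e, hy⟩
  · rintro ⟨e, hy⟩
    by_cases h : W.w c.label e = 0
    · rw [← ih e h] at hy
      obtain ⟨x, hx, hy⟩ := Set.mem_iUnion₂.1 hy
      exact ⟨x, W.expand_sub_subset h hx, hy⟩
    · exact ⟨_, W.mem_expand_self h, hy⟩

theorem support_subset_of_mem_expand {c : Copy d σ.n} {x : W.Label × Copy d σ.n}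
    (hx : x ∈ W.expand c) : x.2.support σ.tile ⊆ c.support σ.tile := by
  rw [← W.iUnion_support_expand c]
  exact Set.subset_biUnion_of_mem (u := fun x : W.Label × Copy d σ.n => x.2.support σ.tile) hx

theorem pairwise_expand (c : Copy d σ.n) (hc : 0 < c.scale) :
    (W.expand c).Pairwise fun x y =>
      Disjoint (interior (x.2.support σ.tile)) (interior (y.2.support σ.tile)) := by
  induction c using W.induction with
  | h c ih =>
  rw [expand, List.pairwise_flatMap]
  constructor
  · intro e _
    split_ifs with h
    · exact ih e h (σ.sub_scale_pos c hc e)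
    · exact List.pairwise_singleton _ _
  · refine (List.nodup_finRange _).imp fun {e e'} hne x hx y hy => ?_
    have key : ∀ e, ∀ x ∈ (if h : W.w c.label e = 0 then W.expand (σ.sub c e)
        else [(⟨c.label, e, ⟨W.w c.label e - 1, by omega⟩⟩, σ.sub c e)]),
        x.2.support σ.tile ⊆ (σ.sub c e).support σ.tile := by
      intro e x hx
      split_ifs at hx with h
      · exact W.support_subset_of_mem_expand hx
      · rw [List.mem_singleton] at hx
        rw [hx]
    exact (σ.disjoint_interior_sub c hc hne).mono (interior_mono (key e x hx))
      (interior_mono (key e' y hy))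

theorem expand_act {k : ℕ} (a : Copy d k) (c : Copy d σ.n) :
    ∀ x ∈ W.expand (a.act c), ∃ y ∈ W.expand c, x = (y.1, a.act y.2) := by
  induction c using W.induction with
  | h c ih =>
  intro x hx
  obtain ⟨e, ⟨h, hx⟩ | ⟨h, rfl⟩⟩ := W.mem_expand.1 hx
  · change W.w c.label e = 0 at h
    rw [sub_act a c e] at hx
    obtain ⟨y, hy, rfl⟩ := ih e h x hx
    exact ⟨y, W.expand_sub_subset h hy, rfl⟩
  · exact ⟨_, W.mem_expand_self (c := c) h, Prod.ext rfl (sub_act a c e)⟩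

/-! ### The fixed scale rule -/

/-- An enumeration of the labels. -/
def labelEquiv : W.Label ≃ Fin (Fintype.card W.Label) := Fintype.equivFin _

/-- The copy of a prototile of the original rule that is the prototile of the fixed scale rule with
a given label; `γ` rotates all prototiles. -/
def proto (γ : E d ≃ₗᵢ[ℝ] E d) (L : W.Label) : Copy d σ.n where
  label := W.target L
  -- The full size is `exp (u)`; each unit still ahead delays one inflation by `exp α`.
  scale := Real.exp (W.u (W.target L) - α * (L.2.2 : ℕ))
  rot := γ
  shift := 0

/-- The pieces of the prototile with a given label: a prototile inside an edge moves on along its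
edge, a prototile at the end of an edge is substituted. -/
def pieces (γ : E d ≃ₗᵢ[ℝ] E d) (L : W.Label) : List (Copy d (Fintype.card W.Label)) :=
  if (L.2.2 : ℕ) = 0 then (W.expand (W.proto γ L)).map fun x =>
    { label := W.labelEquiv x.1
      scale := (Real.exp α)⁻¹
      -- The prototile itself already carries the rotation `γ`.
      rot := x.2.rot * γ⁻¹
      shift := x.2.shift }
  else
    [{ label := W.labelEquiv ⟨L.1, L.2.1, ⟨(L.2.2 : ℕ) - 1, by omega⟩⟩
       scale := (Real.exp α)⁻¹
       rot := 1
       shift := 0 }]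

/-- The copy of a prototile of the original rule underlying a copy of a prototile of the fixed
scale rule. -/
def underlying (γ : E d ≃ₗᵢ[ℝ] E d) (C : Copy d (Fintype.card W.Label)) : Copy d σ.n :=
  C.act (W.proto γ (W.labelEquiv.symm C.label))

theorem underlying_act {k : ℕ} (γ : E d ≃ₗᵢ[ℝ] E d) (a : Copy d k)
    (C : Copy d (Fintype.card W.Label)) : W.underlying γ (a.act C) = a.act (W.underlying γ C) :=
  Copy.act_assoc _ _ _

theorem underlying_mk (γ r : E d ≃ₗᵢ[ℝ] E d) (L : W.Label) (s : ℝ) (v : E d) :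
    W.underlying γ { label := W.labelEquiv L, scale := s, rot := r, shift := v } =
      { label := W.target L
        scale := s * Real.exp (W.u (W.target L) - α * (L.2.2 : ℕ))
        rot := r * γ
        shift := v } := by
  rw [underlying]
  simp only
  rw [Equiv.symm_apply_apply]
  simp only [Copy.act, proto, Copy.mk.injEq, smul_zero, map_zero, add_zero, and_true, true_and]
  rfl

/-- The weight of the last edge exceeds the new label coordinate by one, which is exactly the factor
`exp (-α)` of the rule. -/
theorem underlying_piece {γ : E d ≃ₗᵢ[ℝ] E d} {L : W.Label} (hL : (L.2.2 : ℕ) = 0)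
    {x : W.Label × Copy d σ.n} (hx : x ∈ W.expand (W.proto γ L)) :
    W.underlying γ { label := W.labelEquiv x.1, scale := (Real.exp α)⁻¹, rot := x.2.rot * γ⁻¹,
                     shift := x.2.shift } = x.2 := by
  obtain ⟨h1, h2, h3, -⟩ := W.expand_spec _ x hx
  obtain ⟨L', ⟨l, s, r, v⟩⟩ := x
  rw [underlying_mk]
  simp only [proto] at h1 h2 h3
  simp only [Copy.mk.injEq, and_true, inv_mul_cancel_right]
  refine ⟨h1.symm, ?_⟩
  have h2' : (W.w L'.1 L'.2.1 : ℝ) = (L'.2.2 : ℕ) + 1 := by exact_mod_cast h2.symm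
  rw [h3, h2', hL, ← Real.exp_neg, ← Real.exp_add, ← Real.exp_add, h1]
  congr 1
  push_cast
  ring

/-- The prototile one unit further along the edge is larger by `exp α`, which cancels the scale of
the piece: the tile is tessellated by itself. -/
theorem underlying_shift (γ : E d ≃ₗᵢ[ℝ] E d) {L : W.Label} (hL : (L.2.2 : ℕ) ≠ 0) :
    W.underlying γ { label := W.labelEquiv ⟨L.1, L.2.1, ⟨(L.2.2 : ℕ) - 1, by omega⟩⟩
                     scale := (Real.exp α)⁻¹, rot := 1, shift := 0 } = W.proto γ L := by
  rw [underlying_mk]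
  simp only [proto, Copy.mk.injEq, and_true, one_mul]
  refine ⟨rfl, ?_⟩
  have hb : (((L.2.2 : ℕ) - 1 : ℕ) : ℝ) = (L.2.2 : ℕ) - 1 := by
    rw [Nat.cast_sub (Nat.one_le_iff_ne_zero.2 hL), Nat.cast_one]
  change (Real.exp α)⁻¹ * Real.exp (W.u (W.target L) - α * (((L.2.2 : ℕ) - 1 : ℕ) : ℝ)) = _
  rw [← Real.exp_neg, ← Real.exp_add, hb]
  congr 1
  ring

theorem iUnion_underlying_pieces (γ : E d ≃ₗᵢ[ℝ] E d) (L : W.Label) :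
    ⋃ p ∈ W.pieces γ L, (W.underlying γ p).support σ.tile = (W.proto γ L).support σ.tile := by
  by_cases h : (L.2.2 : ℕ) = 0
  · rw [← W.iUnion_support_expand (W.proto γ L)]
    simp only [pieces, if_pos h, List.mem_map, Set.iUnion_exists, Set.biUnion_and',
      Set.iUnion_iUnion_eq_right]
    exact Set.iUnion₂_congr fun x hx => by rw [W.underlying_piece h hx]
  · simp only [pieces, if_neg h, List.mem_singleton, Set.iUnion_iUnion_eq_left]
    rw [W.underlying_shift γ h]

theorem pairwise_pieces (γ : E d ≃ₗᵢ[ℝ] E d) (L : W.Label) :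
    (W.pieces γ L).Pairwise fun p q => Disjoint (interior ((W.underlying γ p).support σ.tile))
      (interior ((W.underlying γ q).support σ.tile)) := by
  by_cases h : (L.2.2 : ℕ) = 0
  · rw [pieces, if_pos h, List.pairwise_map]
    refine (W.pairwise_expand (W.proto γ L) (Real.exp_pos _)).imp_of_mem fun hx hy hxy => ?_
    rwa [W.underlying_piece h hx, W.underlying_piece h hy]
  · rw [pieces, if_neg h]
    exact List.pairwise_singleton _ _

theorem pieces_spec {γ : E d ≃ₗᵢ[ℝ] E d} (hγ : γ ∈ Γ) {L : W.Label}
    {p : Copy d (Fintype.card W.Label)} (hp : p ∈ W.pieces γ L) :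
    p.scale = (Real.exp α)⁻¹ ∧ p.rot ∈ Γ := by
  by_cases h : (L.2.2 : ℕ) = 0
  · rw [pieces, if_pos h, List.mem_map] at hp
    obtain ⟨x, hx, rfl⟩ := hp
    exact ⟨rfl, Γ.mul_mem ((W.expand_spec _ x hx).2.2.2 hγ) (Γ.inv_mem hγ)⟩
  · rw [pieces, if_neg h, List.mem_singleton] at hp
    subst hp
    exact ⟨rfl, Γ.one_mem⟩

/-- The fixed scale rule obtained by subdividing the edges of the associated graph into segments of
unit weight. -/
def fixedRule {γ : E d ≃ₗᵢ[ℝ] E d} (hγ : γ ∈ Γ) : SubstitutionRule d Γ where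
  n := Fintype.card W.Label
  tile k := (W.proto γ (W.labelEquiv.symm k)).support σ.tile
  isTile k := σ.isTile_support _ (Real.exp_pos _)
  num k := (W.pieces γ (W.labelEquiv.symm k)).length
  piece k e := (W.pieces γ (W.labelEquiv.symm k)).get e
  scale_pos _ e := by
    rw [(W.pieces_spec hγ (List.get_mem _ e)).1]; exact inv_pos.2 (Real.exp_pos α)
  rot_mem _ e := (W.pieces_spec hγ (List.get_mem _ e)).2
  union_eq k := by
    rw [← W.iUnion_underlying_pieces γ (W.labelEquiv.symm k)]
    ext y
    have hs : ∀ p : Copy d (Fintype.card W.Label), (W.underlying γ p).support σ.tile =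
        p.support fun k => (W.proto γ (W.labelEquiv.symm k)).support σ.tile :=
      fun p => Copy.support_act _ _ _
    simp only [Set.mem_iUnion, exists_prop, List.mem_iff_get, hs]
    constructor
    · rintro ⟨e, hy⟩
      exact ⟨_, ⟨e, rfl⟩, hy⟩
    · rintro ⟨_, ⟨e, rfl⟩, hy⟩
      exact ⟨e, hy⟩
  disjoint k := by
    have h := List.pairwise_iff_get.1 (W.pairwise_pieces γ (W.labelEquiv.symm k))
    have hs : ∀ p : Copy d (Fintype.card W.Label), (W.underlying γ p).support σ.tile =
        p.support fun k => (W.proto γ (W.labelEquiv.symm k)).support σ.tile :=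
      fun p => Copy.support_act _ _ _
    simp only [hs] at h
    intro e e' hne
    rcases hne.lt_or_gt with hlt | hlt
    · exact h e e' hlt
    · exact (h e' e hlt).symm

/-! ### Iterates of the fixed scale rule along weighted paths -/

variable {γ : E d ≃ₗᵢ[ℝ] E d} (hγ : γ ∈ Γ)

theorem isFixedScale_fixedRule : (W.fixedRule hγ).IsFixedScale (Real.exp α) where
  one_lt := Real.one_lt_exp_iff.2 W.pos
  scale_eq _ e := (W.pieces_spec hγ (List.get_mem _ e)).1

theorem support_fixedRule (C : Copy d (W.fixedRule hγ).n) :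
    C.support (W.fixedRule hγ).tile = (W.underlying γ C).support σ.tile :=
  (Copy.support_act _ _ _).symm

theorem exists_sub_fixedRule (C : Copy d (W.fixedRule hγ).n)
    {p : Copy d (Fintype.card W.Label)} (hp : p ∈ W.pieces γ (W.labelEquiv.symm C.label)) :
    ∃ e, (W.fixedRule hγ).sub C e = C.act p := by
  obtain ⟨e, rfl⟩ := List.mem_iff_get.1 hp
  exact ⟨e, rfl⟩

/-- A copy inside an edge moves to the end of its edge, step by step. -/
theorem exists_iter_of_le (C : Copy d (W.fixedRule hγ).n) {L : W.Label}
    (hL : W.labelEquiv.symm C.label = L) (m : ℕ) (hm : m ≤ (L.2.2 : ℕ)) :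
    ∃ C', (W.fixedRule hγ).Iter m C C' ∧ W.underlying γ C' = W.underlying γ C ∧
      W.labelEquiv.symm C'.label = ⟨L.1, L.2.1, ⟨(L.2.2 : ℕ) - m, by omega⟩⟩ := by
  induction m with
  | zero => exact ⟨C, .refl C, rfl, hL⟩
  | succ m ih =>
    obtain ⟨C', h1, h2, h3⟩ := ih (by omega)
    have hb : ((W.labelEquiv.symm C'.label).2.2 : ℕ) ≠ 0 := by rw [h3]; simp only; omega
    obtain ⟨e, he⟩ := W.exists_sub_fixedRule hγ C' (by
      rw [pieces, if_neg hb]; exact List.mem_singleton_self _)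
    refine ⟨_, .step _ _ _ e h1, ?_, ?_⟩
    · rw [he, underlying_act, W.underlying_shift γ hb, ← h2]
      rfl
    · rw [he]
      simp only [Copy.act, Equiv.symm_apply_apply]
      generalize W.labelEquiv.symm C'.label = L' at h3
      subst h3
      simp only [Nat.sub_sub]

/-- A copy at the end of an edge is substituted. -/
theorem exists_iter_of_mem_expand (C : Copy d (W.fixedRule hγ).n)
    (hC : ((W.labelEquiv.symm C.label).2.2 : ℕ) = 0) {x : W.Label × Copy d σ.n}
    (hx : x ∈ W.expand (W.underlying γ C)) :
    ∃ C', (W.fixedRule hγ).Iter 1 C C' ∧ W.underlying γ C' = x.2 ∧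
      W.labelEquiv.symm C'.label = x.1 := by
  obtain ⟨y, hy, rfl⟩ := W.expand_act _ _ x hx
  obtain ⟨e, he⟩ := W.exists_sub_fixedRule hγ C (by
    rw [pieces, if_pos hC]; exact List.mem_map_of_mem hy)
  refine ⟨_, .step _ _ _ e (.refl C), ?_, ?_⟩
  · simp only [he, underlying_act, W.underlying_piece hC hy]
    rfl
  · rw [he]
    simp [Copy.act]

/-- Weighted paths in the tree of all iterated substitutions of a copy. -/
inductive Desc (c₀ : Copy d σ.n) : Copy d σ.n → ℕ → Prop
  | refl : Desc c₀ c₀ 0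
  | step (c : Copy d σ.n) (k : ℕ) (e : Fin (σ.num c.label)) :
      Desc c₀ c k → Desc c₀ (σ.sub c e) (k + W.w c.label e)

/-- A descendant is alive in the patches of the fixed scale rule from the end of the weight of its
parent on, until the end of its own weight. -/
theorem exists_iter_edge {C₀ C : Copy d (W.fixedRule hγ).n} {c : Copy d σ.n} {k : ℕ}
    (hiter : (W.fixedRule hγ).Iter k C₀ C)
    (hC : ((W.labelEquiv.symm C.label).2.2 : ℕ) = 0)
    (hsub : W.expand c ⊆ W.expand (W.underlying γ C)) (e : Fin (σ.num c.label)) {m : ℕ}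
    (hm : m < W.w c.label e) :
    ∃ C', (W.fixedRule hγ).Iter (k + 1 + m) C₀ C' ∧ W.underlying γ C' = σ.sub c e ∧
      W.labelEquiv.symm C'.label = ⟨c.label, e, ⟨W.w c.label e - 1 - m, by omega⟩⟩ := by
  have h0 : W.w c.label e ≠ 0 := by omega
  obtain ⟨C1, h1, h2, h3⟩ := W.exists_iter_of_mem_expand hγ C hC (hsub (W.mem_expand_self h0))
  obtain ⟨C2, h4, h5, h6⟩ := W.exists_iter_of_le hγ C1 h3 m (by simp only; omega)
  exact ⟨C2, (hiter.trans h1).trans h4, h5.trans h2, h6⟩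

/-- A descendant entered through an edge of weight zero need not appear as a tile, since it is
expanded at once. What persists is its expansion, contained in that of a tile at the end of an edge.
-/
theorem Desc.exists_iter {C₀ : Copy d (W.fixedRule hγ).n}
    (hC₀ : ((W.labelEquiv.symm C₀.label).2.2 : ℕ) = 0) {c : Copy d σ.n} {k : ℕ}
    (h : W.Desc (W.underlying γ C₀) c k) :
    ∃ C, (W.fixedRule hγ).Iter k C₀ C ∧ ((W.labelEquiv.symm C.label).2.2 : ℕ) = 0 ∧
      W.expand c ⊆ W.expand (W.underlying γ C) := by
  induction h with
  | refl => exact ⟨C₀, .refl _, hC₀, List.Subset.refl _⟩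
  | step c k e _ ih =>
    obtain ⟨C, h1, h2, h3⟩ := ih
    by_cases h0 : W.w c.label e = 0
    · rw [h0]
      exact ⟨C, h1, h2, fun _ hx => h3 (W.expand_sub_subset h0 hx)⟩
    · obtain ⟨C', h4, h5, h6⟩ := W.exists_iter_edge hγ h1 h2 h3 e (m := W.w c.label e - 1)
        (by omega)
      refine ⟨C', ?_, by rw [h6]; simp, by rw [h5]; exact List.Subset.refl _⟩
      rwa [show k + W.w c.label e = k + 1 + (W.w c.label e - 1) by omega]

theorem Desc.act {n : ℕ} (a : Copy d n) {c₀ c : Copy d σ.n} {k : ℕ} (h : W.Desc c₀ c k) :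
    W.Desc (a.act c₀) (a.act c) k := by
  induction h with
  | refl => exact .refl
  | step c k e _ ih =>
    rw [← sub_act]
    exact .step (a.act c) _ e ih

theorem Desc.trans {c₀ c c' : Copy d σ.n} {k l : ℕ} (h : W.Desc c₀ c k) (h' : W.Desc c c' l) :
    W.Desc c₀ c' (k + l) := by
  induction h' with
  | refl => exact h
  | step c k e _ ih =>
    rw [← add_assoc]
    exact .step _ _ e ih

end Weighting

end SubstitutionRule

namespace SubstitutionRule

variable {d : ℕ} {Γ : Subgroup (E d ≃ₗᵢ[ℝ] E d)} {σ : SubstitutionRule d Γ}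

/-! ### Lengths of closed paths -/

theorem Walk.append {i j k : Fin σ.n} {a b : ℝ} (h : σ.Walk i j a) (h' : σ.Walk j k b) :
    σ.Walk i k (a + b) := by
  induction h with
  | nil => rwa [zero_add]
  | cons i e j a _ ih =>
    rw [add_assoc]
    exact .cons i e k _ (ih h')

theorem log_pos_of_scale_lt_one (hlt : ∀ i e, (σ.piece i e).scale < 1) (i : Fin σ.n)
    (e : Fin (σ.num i)) : 0 < Real.log (1 / (σ.piece i e).scale) :=
  Real.log_pos (by rw [lt_div_iff₀ (σ.scale_pos i e), one_mul]; exact hlt i e)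

theorem Walk.nonneg (hlt : ∀ i e, (σ.piece i e).scale < 1) {i j : Fin σ.n} {a : ℝ}
    (h : σ.Walk i j a) : 0 ≤ a := by
  induction h with
  | nil => exact le_rfl
  | cons i e j a _ ih => exact add_nonneg (log_pos_of_scale_lt_one hlt i e).le ih

theorem exists_common_denominator {κ : Type*} [Fintype κ] (q : κ → ℚ) :
    ∃ N : ℕ, 0 < N ∧ ∀ k, ∃ z : ℤ, q k * N = z := by
  refine ⟨∏ k, (q k).den, Finset.prod_pos fun k _ => (q k).pos, fun k => ?_⟩
  obtain ⟨c, hc⟩ := Finset.dvd_prod_of_mem (fun k => (q k).den) (Finset.mem_univ k)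
  refine ⟨(q k).num * c, ?_⟩
  rw [hc]
  push_cast
  rw [← mul_assoc, Rat.mul_den_eq_num]

/-- In the commensurable case the lengths of the edges are, up to a coboundary, integral multiples
of a number `α`, and all large multiples of `α` are lengths of closed paths. -/
theorem exists_period (hlt : ∀ i e, (σ.piece i e).scale < 1) (hirr : σ.IsIrreducible)
    (hcomm : σ.IsCommensurable) (i₀ : Fin σ.n) :
    ∃ α > 0, ∃ h : Fin σ.n → ℝ,
      (∀ i e, ∃ z : ℤ, h i + Real.log (1 / (σ.piece i e).scale) - h (σ.piece i e).label = α * z) ∧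
      ∃ N : ℕ, ∀ k : ℕ, N ≤ k → σ.Walk i₀ i₀ (α * k) := by
  choose h hh using fun j => hirr i₀ j
  choose r hr using fun j => hirr j i₀
  obtain ⟨b, hb, hbw⟩ : ∃ b > 0, σ.Walk i₀ i₀ b :=
    ⟨_, add_pos_of_pos_of_nonneg (log_pos_of_scale_lt_one hlt i₀ ⟨0, σ.num_pos i₀⟩)
      ((hr _).nonneg hlt), .cons _ _ _ _ (hr _)⟩
  have hrat : ∀ a, σ.Walk i₀ i₀ a → ∃ q : ℚ, a = b * q := fun a ha => by
    rcases (ha.nonneg hlt).eq_or_lt with rfl | hpos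
    · exact ⟨0, by simp⟩
    · by_contra hq
      exact hcomm ⟨i₀, i₀, a, b, hpos, hb, ha, hbw, hq⟩
  -- This closed path and the one in `hy` share the return path, so their lengths differ by the edge
  -- length corrected by the coboundary of `h`.
  have hx : ∀ (i) (e : Fin (σ.num i)), σ.Walk i₀ i₀
      (h i + (Real.log (1 / (σ.piece i e).scale) + r (σ.piece i e).label)) := fun i e =>
    (hh i).append (.cons _ _ _ _ (hr _))
  have hy : ∀ j, σ.Walk i₀ i₀ (h j + r j) := fun j => (hh j).append (hr j)
  choose qx hqx using fun k : (Σ i, Fin (σ.num i)) => hrat _ (hx k.1 k.2)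
  choose qy hqy using fun j => hrat _ (hy j)
  obtain ⟨N, hN, hz⟩ := exists_common_denominator
    fun k : (Σ i, Fin (σ.num i)) => qx k - qy (σ.piece k.1 k.2).label
  choose z hz using hz
  set β := b / N with hβ
  have hNr : (0 : ℝ) < N := by exact_mod_cast hN
  have hβpos : 0 < β := by positivity
  have hedge : ∀ (i) (e : Fin (σ.num i)),
      h i + Real.log (1 / (σ.piece i e).scale) - h (σ.piece i e).label = β * z ⟨i, e⟩ := fun i e => by
    have h1 := hqx ⟨i, e⟩
    have h2 := hqy (σ.piece i e).label
    have h3 : (z ⟨i, e⟩ : ℝ) = (qx ⟨i, e⟩ - qy (σ.piece i e).label) * N := by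
      exact_mod_cast (hz ⟨i, e⟩).symm
    simp only at h1
    rw [h3, hβ]
    field_simp
    linarith
  have hwalk : ∀ i j a, σ.Walk i j a → ∃ z : ℤ, h i + a - h j = β * z := by
    intro i j a hw
    induction hw with
    | nil => exact ⟨0, by simp⟩
    | cons i e j a _ ih =>
      obtain ⟨z', hz'⟩ := ih
      refine ⟨z ⟨i, e⟩ + z', ?_⟩
      push_cast
      rw [mul_add, ← hz', ← hedge]
      ring
  have hclosed : ∀ a, σ.Walk i₀ i₀ a → ∃ m : ℕ, a = β * m := fun a ha => by
    obtain ⟨z, hz⟩ := hwalk _ _ _ ha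
    have h1 : a = β * z := by linarith
    have h2 : 0 ≤ z := by
      have := ha.nonneg hlt
      rw [h1] at this
      exact_mod_cast nonneg_of_mul_nonneg_right this hβpos
    obtain ⟨m, rfl⟩ := Int.eq_ofNat_of_zero_le h2
    exact ⟨m, by simpa using h1⟩
  -- A numerical semigroup contains all large multiples of its gcd `g`; the period is `β * g`.
  set M : AddSubmonoid ℕ :=
    { carrier := {m | σ.Walk i₀ i₀ (β * m)}
      zero_mem' := by simpa using Walk.nil i₀
      add_mem' := fun {a b} ha hb => by
        simp only [Set.mem_ofPred_eq] at ha hb ⊢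
        push_cast
        rw [mul_add]
        exact ha.append hb } with hM
  set g := Nat.setGcd (M : Set ℕ) with hg
  have hgm : ∀ a, σ.Walk i₀ i₀ a → ∃ m : ℕ, a = β * g * m := fun a ha => by
    obtain ⟨m, rfl⟩ := hclosed a ha
    obtain ⟨c, hc⟩ := Nat.setGcd_dvd_of_mem (s := (M : Set ℕ)) (n := m) ha
    exact ⟨c, by rw [hc]; push_cast; ring⟩
  have hgpos : 0 < g := by
    obtain ⟨m, hm⟩ := hgm b hbw
    rcases Nat.eq_zero_or_pos g with h0 | h0
    · rw [h0] at hm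
      simp only [Nat.cast_zero, mul_zero, zero_mul] at hm
      exact absurd hm hb.ne'
    · exact h0
  refine ⟨β * g, by positivity, h, fun i e => ?_, ?_⟩
  · obtain ⟨m₁, h₁⟩ := hgm _ (hx i e)
    obtain ⟨m₂, h₂⟩ := hgm _ (hy (σ.piece i e).label)
    refine ⟨m₁ - m₂, ?_⟩
    push_cast
    rw [mul_sub, ← h₁, ← h₂]
    ring
  · obtain ⟨n, hn⟩ := Nat.exists_mem_closure_of_ge (M : Set ℕ)
    refine ⟨n, fun k hk => ?_⟩
    have h1 := hn (g * k) (hk.trans (Nat.le_mul_of_pos_left k hgpos)) (Dvd.intro k rfl)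
    rw [AddSubmonoid.closure_eq] at h1
    have h2 : σ.Walk i₀ i₀ (β * ((g * k : ℕ) : ℝ)) := h1
    rwa [Nat.cast_mul, ← mul_assoc] at h2

/-- Normalized potentials and integral weights for a given phase. -/
theorem exists_potential (hlt : ∀ i e, (σ.piece i e).scale < 1) {α : ℝ} (hα : 0 < α)
    {h : Fin σ.n → ℝ}
    (hh : ∀ i e, ∃ z : ℤ,
      h i + Real.log (1 / (σ.piece i e).scale) - h (σ.piece i e).label = α * z) (θ : ℝ) :
    ∃ (u : Fin σ.n → ℝ) (w : ∀ i, Fin (σ.num i) → ℕ), (∀ j, -α < u j ∧ u j ≤ 0) ∧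
      (∀ j, ∃ z : ℤ, θ - h j = u j + α * z) ∧
      ∀ i e, Real.log (1 / (σ.piece i e).scale) = u i - u (σ.piece i e).label + α * w i e := by
  -- Reduction modulo `α` changes potentials by multiples of `α`, so integrality survives.
  set u : Fin σ.n → ℝ := fun j => toIocMod hα (-α) (θ - h j) with hu
  have hmem : ∀ j, -α < u j ∧ u j ≤ 0 := fun j => by
    have := toIocMod_mem_Ioc hα (-α) (θ - h j)
    rwa [neg_add_cancel] at this
  have hz : ∀ j, ∃ z : ℤ, θ - h j = u j + α * z := fun j =>
    ⟨toIocDiv hα (-α) (θ - h j), by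
      have := toIocMod_add_toIocDiv_zsmul hα (-α) (θ - h j)
      rw [zsmul_eq_mul, mul_comm] at this
      exact this.symm⟩
  have key : ∀ i e, ∃ m : ℕ,
      Real.log (1 / (σ.piece i e).scale) = u i - u (σ.piece i e).label + α * m := fun i e => by
    obtain ⟨z, hze⟩ := hh i e
    obtain ⟨z₁, h₁⟩ := hz i
    obtain ⟨z₂, h₂⟩ := hz (σ.piece i e).label
    have hl := log_pos_of_scale_lt_one hlt i e
    have heq : Real.log (1 / (σ.piece i e).scale) =
        u i - u (σ.piece i e).label + α * ((z + z₁ - z₂ : ℤ) : ℝ) := by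
      push_cast
      linarith
    -- The edge length is positive and potentials differ by less than `α`, so the weight exceeds
    -- `-1`.
    have hpos : (-1 : ℤ) < z + z₁ - z₂ := by
      have h3 := (hmem i).2
      have h4 := (hmem (σ.piece i e).label).1
      have h5 : α * (-1) < α * ((z + z₁ - z₂ : ℤ) : ℝ) := by linarith
      exact_mod_cast lt_of_mul_lt_mul_left h5 hα.le
    obtain ⟨m, hm⟩ := Int.eq_ofNat_of_zero_le (show 0 ≤ z + z₁ - z₂ by omega)
    exact ⟨m, by rw [heq, hm]; simp⟩
  choose w hw using key
  exact ⟨u, w, hmem, hz, hw⟩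

theorem scale_eq_exp_of_log_eq {i : Fin σ.n} {e : Fin (σ.num i)} {x : ℝ}
    (h : Real.log (1 / (σ.piece i e).scale) = x) : (σ.piece i e).scale = Real.exp (-x) := by
  rw [← h, one_div, Real.log_inv, neg_neg, Real.exp_log (σ.scale_pos i e)]

namespace Weighting

variable {α : ℝ} (W : σ.Weighting α)

/-! ### Primitivity of the fixed scale rule -/

theorem log_scale (i : Fin σ.n) (e : Fin (σ.num i)) :
    Real.log (1 / (σ.piece i e).scale) = W.u i - W.u (σ.piece i e).label + α * W.w i e := by
  rw [W.scale_eq, one_div, ← Real.exp_neg, Real.log_exp]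
  ring

theorem exists_desc_of_walk {i j : Fin σ.n} {a : ℝ} (h : σ.Walk i j a) :
    ∃ k : ℕ, a = W.u i - W.u j + α * k ∧
      ∀ c : Copy d σ.n, c.label = i → ∃ c', W.Desc c c' k ∧ c'.label = j := by
  induction h with
  | nil i => exact ⟨0, by simp, fun c hc => ⟨c, .refl, hc⟩⟩
  | cons i e j a _ ih =>
    obtain ⟨k, hk, hc⟩ := ih
    refine ⟨W.w i e + k, ?_, ?_⟩
    · rw [W.log_scale, hk]
      push_cast
      ring
    · rintro c rfl
      obtain ⟨c', h1, h2⟩ := hc (σ.sub c e) rfl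
      refine ⟨c', ?_, h2⟩
      have := (Desc.step c 0 e .refl).trans W h1
      rwa [zero_add] at this

/-- There are paths of all large weights between any two vertices. -/
theorem exists_desc_of_large (hirr : σ.IsIrreducible) {i₀ : Fin σ.n} {N : ℕ}
    (hN : ∀ k : ℕ, N ≤ k → σ.Walk i₀ i₀ (α * k)) :
    ∃ K, ∀ k ≥ K, ∀ (c : Copy d σ.n) (j : Fin σ.n), ∃ c', W.Desc c c' k ∧ c'.label = j := by
  have h : ∀ i j, ∃ k, ∀ c : Copy d σ.n, c.label = i → ∃ c', W.Desc c c' k ∧ c'.label = j :=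
    fun i j => by
      obtain ⟨a, ha⟩ := hirr i j
      obtain ⟨k, -, hk⟩ := W.exists_desc_of_walk ha
      exact ⟨k, hk⟩
  choose p hp using h
  refine ⟨N + ∑ i, p i i₀ + ∑ j, p i₀ j, fun k hk c j => ?_⟩
  have h1 : p c.label i₀ ≤ ∑ i, p i i₀ :=
    Finset.single_le_sum (f := fun i => p i i₀) (fun _ _ => Nat.zero_le _) (Finset.mem_univ _)
  have h2 : p i₀ j ≤ ∑ j, p i₀ j :=
    Finset.single_le_sum (f := fun j => p i₀ j) (fun _ _ => Nat.zero_le _) (Finset.mem_univ _)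
  obtain ⟨m, rfl⟩ : ∃ m, k = p c.label i₀ + (N + m) + p i₀ j :=
    ⟨k - p c.label i₀ - N - p i₀ j, by omega⟩
  obtain ⟨c₁, hc₁, hl₁⟩ := hp c.label i₀ c rfl
  obtain ⟨k', hk', hc'⟩ := W.exists_desc_of_walk (hN (N + m) (by omega))
  have : k' = N + m := by
    rw [sub_self, zero_add] at hk'
    exact_mod_cast (mul_left_cancel₀ W.pos.ne' hk').symm
  subst this
  obtain ⟨c₂, hc₂, hl₂⟩ := hc' c₁ hl₁
  obtain ⟨c₃, hc₃, hl₃⟩ := hp i₀ j c₂ hl₂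
  exact ⟨c₃, (hc₁.trans W hc₂).trans W hc₃, hl₃⟩

/-- If all weights vanished, no path could have large weight. This provides a label to start from.
-/
theorem exists_weight_pos (hirr : σ.IsIrreducible) {i₀ : Fin σ.n} {N : ℕ}
    (hN : ∀ k : ℕ, N ≤ k → σ.Walk i₀ i₀ (α * k)) : ∃ i e, 0 < W.w i e := by
  by_contra! hw
  obtain ⟨K, hK⟩ := W.exists_desc_of_large hirr hN
  obtain ⟨c, hc, -⟩ := hK (K + 1) (by omega) (Copy.root i₀ 1) i₀
  have : ∀ k c, W.Desc (Copy.root i₀ 1) c k → k = 0 := by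
    intro k c h
    induction h with
    | refl => rfl
    | step c k e _ ih => rw [ih, Nat.le_zero.1 (hw _ e)]
  exact absurd (this _ _ hc) (by omega)

variable {γ : E d ≃ₗᵢ[ℝ] E d} (hγ : γ ∈ Γ)

theorem isPrimitive_fixedRule (hirr : σ.IsIrreducible) {i₀ : Fin σ.n} {N : ℕ}
    (hN : ∀ k : ℕ, N ≤ k → σ.Walk i₀ i₀ (α * k)) : (W.fixedRule hγ).IsPrimitive := by
  obtain ⟨K, hK⟩ := W.exists_desc_of_large hirr hN
  have hB : ∀ i e, W.w i e ≤ ∑ i, ∑ e, W.w i e := fun i e =>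
    (Finset.single_le_sum (f := fun e => W.w i e) (fun _ _ => Nat.zero_le _)
      (Finset.mem_univ e)).trans
      (Finset.single_le_sum (f := fun i => ∑ e, W.w i e) (fun _ _ => Nat.zero_le _)
        (Finset.mem_univ i))
  set B := ∑ i, ∑ e, W.w i e with hBdef
  -- Finishing the current edge and advancing to the prescribed point of the target edge cost at
  -- most `B` each, entering that edge costs one, and at least `K` remains for a path of prescribed
  -- weight between them.
  refine ⟨matrix_nonneg, K + 1 + 2 * B, by omega, fun i j => ?_⟩
  obtain ⟨C₁, h₁, -, hl₁⟩ := W.exists_iter_of_le hγ (Copy.root j 1) (L := W.labelEquiv.symm j) rfl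
    _ le_rfl
  obtain ⟨⟨i', e', b'⟩, rfl⟩ := W.labelEquiv.surjective i
  set b : ℕ := ((W.labelEquiv.symm j).2.2 : ℕ) with hb
  have hbB : b ≤ B := (W.labelEquiv.symm j).2.2.2.le.trans (hB _ _)
  have hwB := hB i' e'
  obtain ⟨c, hc, rfl⟩ := hK (K + 2 * B - b - (W.w i' e' - 1 - b')) (by omega)
    (W.underlying γ C₁) i'
  obtain ⟨C₂, h₂, hb₂, hs₂⟩ := hc.exists_iter W hγ (by rw [hl₁]; simp)
  obtain ⟨C₃, h₃, -, hl₃⟩ := W.exists_iter_edge hγ h₂ hb₂ hs₂ e' (m := W.w c.label e' - 1 - b')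
    (by have := b'.2; omega)
  have h := (h₁.trans h₃).matrix_pow_pos
  have hlab : C₃.label = W.labelEquiv ⟨c.label, e', b'⟩ := by
    rw [← W.labelEquiv.apply_symm_apply C₃.label, hl₃]
    congr 3
    exact Fin.ext (by have := b'.2; simp only; omega)
  rw [hlab] at h
  have hk : b + (K + 2 * B - b - (W.w c.label e' - 1 - b') + 1 + (W.w c.label e' - 1 - b')) =
      K + 1 + 2 * B := by omega
  rw [hk] at h
  exact h

/-! ### Tiles of the substitution semi-flow -/

theorem volume_support_le_one_iff (hd : 0 < d) (hvol : ∀ i, MeasureTheory.volume (σ.tile i) = 1)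
    {c : Copy d σ.n} (hc : 0 < c.scale) :
    MeasureTheory.volume (c.support σ.tile) ≤ 1 ↔ c.scale ≤ 1 := by
  rw [Copy.support_eq, volume_image_place c hc, hvol, mul_one, ENNReal.ofReal_le_one,
    pow_le_one_iff_of_nonneg hc.le hd.ne']

/-- The tiles produced by the semi-flow, at a phase with the given weights, are underlying to tiles
produced by the fixed scale rule. -/
theorem exists_iter_of_refines (hd : 0 < d)
    (hvol : ∀ i, MeasureTheory.volume (σ.tile i) = 1) {u : Fin σ.n → ℝ}
    (hu : ∀ j, -α < u j ∧ u j ≤ 0)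
    (huw : ∀ i e, (σ.piece i e).scale = Real.exp (u (σ.piece i e).label - u i - α * W.w i e))
    {C₀ : Copy d (W.fixedRule hγ).n} (hC₀ : ((W.labelEquiv.symm C₀.label).2.2 : ℕ) = 0)
    {n : ℕ} (a : Copy d n) {M : ℕ} {c c' : Copy d σ.n} (h : σ.Refines c c') (k : ℕ) (hk : k < M)
    (hs : c.scale = Real.exp (u c.label + α * (M - k)))
    (hdesc : W.Desc (W.underlying γ C₀) (a.act c) k) :
    ∃ C, (W.fixedRule hγ).Iter M C₀ C ∧ W.underlying γ C = a.act c' := by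
  induction h generalizing k with
  | done c hv =>
    exfalso
    rw [volume_support_le_one_iff hd hvol (by rw [hs]; exact Real.exp_pos _), hs,
      Real.exp_le_one_iff] at hv
    have h1 := (hu c.label).1
    have h2 : (1 : ℝ) ≤ M - k := by
      rw [le_sub_iff_add_le]
      exact_mod_cast (by omega : 1 + k ≤ M)
    nlinarith [W.pos]
  | step c e c' _ href ih =>
    have hs' : (σ.sub c e).scale =
        Real.exp (u (σ.sub c e).label + α * (M - (k + W.w c.label e : ℕ))) := by
      simp only [sub]
      rw [hs, huw, ← Real.exp_add]
      congr 1
      push_cast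
      ring
    -- Since `u` takes values in `(-α, 0]`, the child is small exactly when its weight reaches `M`.
    -- In that case the flow stops at it, and the fixed scale rule meets it at time `M`, after `M -
    -- k - 1` further units inside its edge.
    rcases lt_or_ge (k + W.w c.label e) M with hlt | hge
    · refine ih _ hlt hs' ?_
      have := Desc.step (a.act c) k e hdesc
      rwa [sub_act] at this
    · have hle : (σ.sub c e).scale ≤ 1 := by
        rw [hs', Real.exp_le_one_iff]
        have h1 := (hu (σ.sub c e).label).2
        have h2 : (M : ℝ) ≤ (k + W.w c.label e : ℕ) := by exact_mod_cast hge
        nlinarith [W.pos]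
      have hv := (volume_support_le_one_iff hd hvol (by rw [hs']; exact Real.exp_pos _)).2 hle
      have heq : c' = σ.sub c e := by
        cases href with
        | done => rfl
        | step _ _ _ hv' => exact absurd hv' hv.not_gt
      obtain ⟨C, h₁, h₂, h₃⟩ := hdesc.exists_iter W hγ hC₀
      obtain ⟨C', h₄, h₅, -⟩ := W.exists_iter_edge hγ h₁ h₂ h₃ (c := a.act c) e (m := M - k - 1)
        (by change M - k - 1 < W.w c.label e; omega)
      refine ⟨C', ?_, by rw [h₅, heq, sub_act]⟩
      rwa [show k + 1 + (M - k - 1) = M by omega] at h₄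

end Weighting

end SubstitutionRule

namespace SubstitutionRule

variable {d : ℕ} {Γ : Subgroup (E d ≃ₗᵢ[ℝ] E d)} {σ : SubstitutionRule d Γ}

/-! ### Embedding the patches of the semi-flow into patches of the fixed scale rule -/

namespace Weighting

variable {α : ℝ} (W : σ.Weighting α)

theorem Desc.rot_mem {c₀ c : Copy d σ.n} {k : ℕ} (h : W.Desc c₀ c k) (h₀ : c₀.rot ∈ Γ) :
    c.rot ∈ Γ := by
  induction h with
  | refl => exact h₀
  | step c k e _ ih => exact Γ.mul_mem ih (σ.rot_mem _ e)

theorem Desc.scale_eq {c₀ c : Copy d σ.n} {k : ℕ} (h : W.Desc c₀ c k) :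
    c.scale = c₀.scale * Real.exp (W.u c.label - W.u c₀.label - α * k) := by
  induction h with
  | refl => simp
  | step c k e _ ih =>
    simp only [sub]
    rw [ih, W.scale_eq, mul_assoc, ← Real.exp_add]
    congr 2
    push_cast
    ring

/-- After a rotation of all prototiles, a given prototile of the original rule descends, unrotated,
from the prototile with a given label. -/
theorem exists_rot_desc (hirr : σ.IsIrreducible) {L : W.Label} (hL : (L.2.2 : ℕ) = 0)
    (i : Fin σ.n) :
    ∃ γ ∈ Γ, ∃ (V : E d) (k : ℕ), W.Desc (W.proto γ L)
      { label := i, scale := Real.exp (W.u i - α * k), rot := 1, shift := V } k := by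
  obtain ⟨a, ha⟩ := hirr (W.target L) i
  obtain ⟨k, -, hk⟩ := W.exists_desc_of_walk ha
  obtain ⟨c, hc, rfl⟩ := hk (W.proto 1 L) rfl
  refine ⟨c.rot⁻¹, Γ.inv_mem (hc.rot_mem W Γ.one_mem), c.rot⁻¹ c.shift, k, ?_⟩
  have h := hc.act W
    ({ label := c.label, scale := 1, rot := c.rot⁻¹, shift := 0 } : Copy d σ.n)
  have h₁ : ({ label := c.label, scale := 1, rot := c.rot⁻¹, shift := 0 } : Copy d σ.n).act
      (W.proto 1 L) = W.proto c.rot⁻¹ L := by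
    simp only [Copy.act, proto, Copy.mk.injEq, one_mul, map_zero, smul_zero, add_zero, and_true,
      true_and]
    exact mul_one _
  have h₂ : ({ label := c.label, scale := 1, rot := c.rot⁻¹, shift := 0 } : Copy d σ.n).act c =
      { label := c.label, scale := Real.exp (W.u c.label - α * k), rot := 1,
        shift := c.rot⁻¹ c.shift } := by
    simp only [Copy.act, Copy.mk.injEq, one_mul, one_smul, zero_add, and_true, true_and]
    refine ⟨?_, inv_mul_cancel _⟩
    rw [hc.scale_eq W]
    simp only [proto, hL]
    rw [← Real.exp_add]
    congr 1
    push_cast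
    ring
  rwa [h₁, h₂] at h

/-- The root `e^t Tᵢ` is placed on the copy of `Tᵢ` at weight `k₀` below `L`; the flow then stops at
weight `k₀ + z`. The weights are common to both potentials, and the factor `exp (W.u i - u i)` is
what remains after inflating by `exp (α * (k₀ + z))`. -/
theorem exists_labelledPatch_of_flow (hd : 0 < d)
    (hvol : ∀ i, MeasureTheory.volume (σ.tile i) = 1) {γ : E d ≃ₗᵢ[ℝ] E d} (hγ : γ ∈ Γ)
    {L : W.Label} (hL : (L.2.2 : ℕ) = 0) {i : Fin σ.n} {V : E d} {k₀ : ℕ}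
    (hdesc : W.Desc (W.proto γ L)
      { label := i, scale := Real.exp (W.u i - α * k₀), rot := 1, shift := V } k₀)
    {u : Fin σ.n → ℝ} (hu : ∀ j, -α < u j ∧ u j ≤ 0)
    (huw : ∀ i e, (σ.piece i e).scale = Real.exp (u (σ.piece i e).label - u i - α * W.w i e))
    {t : ℝ} (ht : 0 < t) {z : ℤ} (htz : t = u i + α * z) :
    ∃ (M : ℕ) (v : E d), ∀ c ∈ σ.flow t i, ∃ l,
      (l, (fun y => v + Real.exp (W.u i - u i) • y) '' c.support σ.tile) ∈
        (W.fixedRule hγ).labelledPatch (Real.exp α) M (W.labelEquiv L) := by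
  -- Positivity of `t` makes the stopping weight strictly larger than `k₀`.
  have hz : 0 < z := by
    have h1 := (hu i).2
    have h2 : 0 < α * (z : ℝ) := by linarith
    exact_mod_cast pos_of_mul_pos_right h2 W.pos.le
  obtain ⟨k, rfl⟩ := Int.eq_ofNat_of_zero_le hz.le
  rw [Int.cast_natCast] at htz
  set a : Copy d σ.n :=
    { label := i, scale := Real.exp (W.u i - α * k₀ - t), rot := 1, shift := V } with ha
  have hact : a.act (Copy.root i (Real.exp t)) =
      { label := i, scale := Real.exp (W.u i - α * k₀), rot := 1, shift := V } := by
    simp only [ha, Copy.act, Copy.root, Copy.mk.injEq, ← Real.exp_add, sub_add_cancel, map_zero,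
      smul_zero, add_zero, and_true, true_and]
    rfl
  set C₀ : Copy d (W.fixedRule hγ).n := Copy.root (W.labelEquiv L) 1 with hC₀
  have hlabel : W.labelEquiv.symm C₀.label = L := W.labelEquiv.symm_apply_apply L
  have hunder : W.underlying γ C₀ = W.proto γ L := by
    refine (W.underlying_mk γ 1 L 1 0).trans ?_
    simp only [proto, one_mul]
  have hM : ((k₀ + k : ℕ) : ℝ) - k₀ = k := by push_cast; ring
  have hroot : (Copy.root (W.labelEquiv L) (Real.exp α ^ (k₀ + k)) : Copy d (W.fixedRule hγ).n) =
      (Copy.root (d := d) i (Real.exp α ^ (k₀ + k))).act C₀ := by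
    rw [← Copy.inflate_eq_act]
    simp [Copy.inflate, Copy.root, hC₀]
  refine ⟨k₀ + k, Real.exp α ^ (k₀ + k) • V, fun c hc => ?_⟩
  obtain ⟨C, h₁, h₂⟩ := W.exists_iter_of_refines hγ hd hvol hu huw (C₀ := C₀)
    (by rw [hlabel]; exact hL) a (M := k₀ + k) (c := Copy.root i (Real.exp t)) hc k₀
    (by have : 0 < k := by exact_mod_cast hz
        omega)
    (by rw [hM]; simp only [Copy.root]; rw [htz]) (by rw [hact, hunder]; exact hdesc)
  have h₃ := h₁.act (Copy.root (d := d) i (Real.exp α ^ (k₀ + k)))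
  rw [← hroot] at h₃
  refine ⟨C.label, _, h₃, Prod.ext rfl ?_⟩
  simp only
  rw [Copy.support_act, support_fixedRule, h₂, Copy.support_act, Set.image_image]
  refine Set.image_congr fun y _ => ?_
  rw [Copy.place_root, Copy.place, smul_add, smul_smul, ← Real.exp_nat_mul, ← Real.exp_add]
  congr 2
  congr 1
  rw [htz]
  push_cast
  ring

end Weighting

/-! ### Tiles of the semi-flow -/

theorem Refines.scale_le_one (hd : 0 < d) (hvol : ∀ i, MeasureTheory.volume (σ.tile i) = 1)
    {c c' : Copy d σ.n} (h : σ.Refines c c') (hc : 0 < c.scale) :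
    0 < c'.scale ∧ c'.scale ≤ 1 := by
  induction h with
  | done c hv => exact ⟨hc, (Weighting.volume_support_le_one_iff hd hvol hc).1 hv⟩
  | step c e c' _ _ ih => exact ih (σ.sub_scale_pos c hc e)

theorem exists_dist_le_of_mem_flow (hd : 0 < d)
    (hvol : ∀ i, MeasureTheory.volume (σ.tile i) = 1) :
    ∃ D, ∀ t i, ∀ c ∈ σ.flow t i, ∀ v, ∀ x ∈ translate v (c.support σ.tile),
      ∀ y ∈ translate v (c.support σ.tile), dist x y ≤ D := by
  have h : Bornology.IsBounded (⋃ j, σ.tile j) :=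
    (Bornology.isBounded_iUnion).2 fun j => (σ.isTile j).isCompact.isBounded
  obtain ⟨D, hD⟩ := Metric.isBounded_iff.1 h
  refine ⟨D, ?_⟩
  rintro t i c hc v _ ⟨_, ⟨x, hx, rfl⟩, rfl⟩ _ ⟨_, ⟨y, hy, rfl⟩, rfl⟩
  have hs := Refines.scale_le_one hd hvol hc (Real.exp_pos t)
  have h1 := hD (Set.mem_iUnion.2 ⟨_, hx⟩) (Set.mem_iUnion.2 ⟨_, hy⟩)
  have h2 := dist_place c x y
  simp only [dist_add_left, Copy.place] at h2 ⊢
  rw [h2, abs_of_pos hs.1]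
  exact (mul_le_of_le_one_left dist_nonneg hs.2).trans h1

theorem eq_root_of_mem_flow_zero (hd : 0 < d) (hvol : ∀ i, MeasureTheory.volume (σ.tile i) = 1)
    {i : Fin σ.n} {c : Copy d σ.n} (hc : c ∈ σ.flow 0 i) : c = Copy.root i 1 := by
  rw [flow, Real.exp_zero] at hc
  have hle : MeasureTheory.volume ((Copy.root i 1).support σ.tile) ≤ 1 :=
    (Weighting.volume_support_le_one_iff hd hvol (by simp [Copy.root])).2 le_rfl
  cases hc with
  | done => rfl
  | step _ _ _ hv => exact absurd hv hle.not_gt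

end SubstitutionRule

namespace SubstitutionRule

variable {d : ℕ} {Γ : Subgroup (E d ≃ₗᵢ[ℝ] E d)}

/-! ### Multiscale tilings in the commensurable case -/

theorem isTranslatedLabelledSubpatch_of_trivial_group (hd : 0 < d) (hΓ : Γ = ⊥)
    {ρ : SubstitutionRule d Γ} {ξ : ℝ} (hρ : ρ.IsFixedScale ξ) (hprim : ρ.IsPrimitive)
    {𝒯 : Set (Fin ρ.n × Set (E d))} (h𝒯 : IsSubstitutionTiling ρ ξ 𝒯)
    (hflc : HasFiniteLocalComplexity (forgetLabels 𝒯)) {P : Set (Fin ρ.n × Set (E d))}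
    (hP : P ⊆ 𝒯) (hfin : P.Finite) :
    IsTranslatedLabelledSubpatch (ρ.generatingLabelledPatches ξ) P := by
  subst hΓ
  exact isTranslatedLabelledSubpatch_of_finiteLocalComplexity hd hρ hprim h𝒯 hflc hP hfin

/-- A choice, for every finite set of tiles and every precision, of an approximating sub-patch of
the semi-flow. -/
theorem exists_approximation {σ : SubstitutionRule d Γ} {𝒯 : Set (Set (E d))}
    (h𝒯 : IsMultiscaleSubstitutionTiling σ 𝒯) (x : Finset 𝒯 × ℕ) :
    ∃ (t : ℝ) (i : Fin σ.n) (v : E d) (f : 𝒯 → Set (E d)), 0 ≤ t ∧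
      Set.InjOn f (x.1 : Set 𝒯) ∧ (∀ T ∈ x.1, ∃ c ∈ σ.flow t i, f T = c.support σ.tile) ∧
      ∀ T ∈ x.1, cfDist T.1 (translate v (f T)) < 1 / ((x.2 : ℝ) + 1) := by
  obtain ⟨G, ⟨t, i, ht, rfl⟩, v, f, hinj, hmaps, hf⟩ := h𝒯.isLimit
    (Subtype.val '' (x.1 : Set 𝒯)) (by rintro _ ⟨T, -, rfl⟩; exact T.2)
    (x.1.finite_toSet.image _) _ (Nat.one_div_pos_of_nat (n := x.2))
  refine ⟨t, i, v, fun T => f T, ht, fun T hT T' hT' h => Subtype.ext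
    (hinj ⟨T, hT, rfl⟩ ⟨T', hT', rfl⟩ h), fun T hT => ?_, fun T hT => hf _ ⟨T, hT, rfl⟩⟩
  obtain ⟨c, hc, h⟩ := hmaps ⟨T, hT, rfl⟩
  exact ⟨c, hc, h.symm⟩

-- Bounded potentials bound the weights, so one weight system prevails along `U`, and the potentials
-- converge by compactness. A limit may equal `-α`, which is harmless because `Weighting` does not
-- prescribe the interval.
open Filter Topology in
theorem exists_weighting_of_approximation {X : Type*} (U : Ultrafilter X)
    {σ : SubstitutionRule d Γ} (hlt : ∀ i e, (σ.piece i e).scale < 1) {α : ℝ} (hα : 0 < α)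
    (u : X → Fin σ.n → ℝ) (w : X → ∀ i, Fin (σ.num i) → ℕ)
    (hu : ∀ x j, -α < u x j ∧ u x j ≤ 0)
    (huw : ∀ x i e,
      Real.log (1 / (σ.piece i e).scale) = u x i - u x (σ.piece i e).label + α * w x i e) :
    ∃ W : σ.Weighting α, (∀ᶠ x in U, w x = W.w) ∧ ∀ j, Tendsto (fun x => u x j) U (𝓝 (W.u j)) := by
  have hbound : ∃ B : ℕ, ∀ x i e, w x i e ≤ B := by
    obtain ⟨B, hB⟩ := exists_nat_ge
      ((∑ i, ∑ e, Real.log (1 / (σ.piece i e).scale) + α) / α)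
    refine ⟨B, fun x i e => ?_⟩
    have h1 : Real.log (1 / (σ.piece i e).scale) ≤
        ∑ i, ∑ e, Real.log (1 / (σ.piece i e).scale) :=
      (Finset.single_le_sum (f := fun e => Real.log (1 / (σ.piece i e).scale))
        (fun e _ => (log_pos_of_scale_lt_one hlt i e).le) (Finset.mem_univ e)).trans
      (Finset.single_le_sum (f := fun i => ∑ e, Real.log (1 / (σ.piece i e).scale))
        (fun i _ => Finset.sum_nonneg fun e _ => (log_pos_of_scale_lt_one hlt i e).le)
        (Finset.mem_univ i))
    have h2 := (hu x i).1
    have h3 := (hu x (σ.piece i e).label).2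
    have h4 := huw x i e
    rw [div_le_iff₀ hα] at hB
    have h5 : (w x i e : ℝ) * α ≤ B * α := by linarith
    exact_mod_cast le_of_mul_le_mul_right h5 hα
  obtain ⟨B, hB⟩ := hbound
  obtain ⟨w₁, hw₁⟩ := exists_eventually_of_finite (κ := ∀ i, Fin (σ.num i) → Fin (B + 1)) U
    (fun x w₁ => ∀ i e, w x i e = w₁ i e) (Eventually.of_forall fun x =>
      ⟨fun i e => ⟨w x i e, Nat.lt_succ_of_le (hB x i e)⟩, fun i e => rfl⟩)
  have hcompact : IsCompact (Set.univ.pi fun _ : Fin σ.n => Set.Icc (-α) 0) :=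
    isCompact_univ_pi fun _ => isCompact_Icc
  obtain ⟨v, -, hv⟩ := hcompact.ultrafilter_le_nhds (U.map u) (by
    rw [le_principal_iff]
    exact Ultrafilter.mem_map.2 (Filter.univ_mem' fun x j _ => ⟨(hu x j).1.le, (hu x j).2⟩))
  have hlim : ∀ j, Tendsto (fun x => u x j) U (𝓝 (v j)) := fun j =>
    ((continuous_apply j).tendsto v).comp hv
  refine ⟨⟨hα, v, fun i e => w₁ i e, fun i e => ?_, hlt⟩, hw₁.mono fun x hx => ?_, hlim⟩
  · have h1 : Tendsto (fun x => u x i - u x (σ.piece i e).label + α * (w₁ i e : ℕ)) U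
        (𝓝 (v i - v (σ.piece i e).label + α * (w₁ i e : ℕ))) :=
      ((hlim i).sub (hlim _)).add tendsto_const_nhds
    have h2 : Tendsto (fun x => u x i - u x (σ.piece i e).label + α * (w₁ i e : ℕ)) U
        (𝓝 (Real.log (1 / (σ.piece i e).scale))) := by
      refine tendsto_const_nhds.congr' (hw₁.mono fun x hx => ?_)
      rw [huw x i e, hx i e]
    rw [scale_eq_exp_of_log_eq (tendsto_nhds_unique h2 h1)]
    congr 1
    ring
  · funext i e
    exact hx i e

/-- A set close to a bounded set stays close to it under scaling by a factor close to one. -/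
theorem close_smul {T A : Set (E d)} {R : ℝ} (hT : T ⊆ Metric.closedBall 0 R) {δ s : ℝ}
    (hδ1 : δ ≤ 1) (h : Close δ T A) (hs : |s - 1| * (|R| + 1) < δ) :
    Close (δ + δ) T ((fun y => s • y) '' A) := by
  have h1 : Close δ A ((fun y => s • y) '' A) := by
    have h2 : Close δ ((fun y : E d => y) '' A) ((fun y => s • y) '' A) :=
      close_image _ _ _ fun y hy => by
        obtain ⟨b, hb, hyb⟩ := Metric.mem_thickening_iff.1 (h.2 hy)
        have h3 := hT hb
        rw [mem_closedBall_zero_iff] at h3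
        rw [dist_eq_norm] at hyb
        have h4 := norm_add_le (y - b) b
        rw [sub_add_cancel] at h4
        have h5 : ‖y‖ ≤ |R| + 1 := by linarith [le_abs_self R]
        rw [dist_comm, dist_eq_norm, show s • y - y = (s - 1) • y by rw [sub_smul, one_smul],
          norm_smul, Real.norm_eq_abs]
        exact (mul_le_mul_of_nonneg_left h5 (abs_nonneg _)).trans_lt hs
    rwa [Set.image_id'] at h2
  exact h.trans h1

-- The index runs over finite sets of tiles and precisions. One ultrafilter fixes the root, the
-- weights, the limit potentials and the label of every tile simultaneously, so the labels are
-- consistent on all patches.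
open Filter Topology in
theorem exists_fixedScale_of_commensurable (hd : 0 < d) (σ : SubstitutionRule d Γ)
    (hmulti : σ.IsMultiscale) (hirr : σ.IsIrreducible) (hcomm : σ.IsCommensurable)
    (𝒯 : Set (Set (E d))) (h𝒯 : IsMultiscaleSubstitutionTiling σ 𝒯) :
    ∃ (ρ : SubstitutionRule d Γ) (ξ : ℝ) (𝒯' : Set (Fin ρ.n × Set (E d))),
      ρ.IsFixedScale ξ ∧ ρ.IsPrimitive ∧ IsSubstitutionTiling ρ ξ 𝒯' ∧ 𝒯 = forgetLabels 𝒯' := by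
  classical
  have hlt := hmulti.scale_lt_one
  have hvol := hmulti.volume_tile
  choose t i v f ht hinj hflow hcf using exists_approximation h𝒯
  obtain ⟨α, hα, h, hh, N, hN⟩ := exists_period hlt hirr hcomm (i (∅, 0))
  -- With this phase, `t x` equals `u x (i x)` up to a multiple of `α`.
  choose u w hu hθ huw using fun x => exists_potential hlt hα hh (t x + h (i x))
  set U : Ultrafilter (Finset 𝒯 × ℕ) := Ultrafilter.of atTop with hU
  have hUle : ∀ {p : Finset 𝒯 × ℕ → Prop}, (∀ᶠ x in atTop, p x) → ∀ᶠ x in U, p x :=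
    fun hp => Ultrafilter.of_le atTop hp
  have hmem : ∀ T : 𝒯, ∀ᶠ x : Finset 𝒯 × ℕ in U, T ∈ x.1 := fun T => hUle <| by
    filter_upwards [eventually_ge_atTop (({T}, 0) : Finset 𝒯 × ℕ)] with x hx
    exact Finset.singleton_subset_iff.1 hx.1
  have hprec : ∀ ε > 0, ∀ᶠ x : Finset 𝒯 × ℕ in U, 1 / ((x.2 : ℝ) + 1) < ε := fun ε hε => hUle <| by
    obtain ⟨n, hn⟩ := exists_nat_one_div_lt hε
    filter_upwards [eventually_ge_atTop ((∅, n) : Finset 𝒯 × ℕ)] with x hx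
    exact (one_div_le_one_div_of_le (by positivity)
      (by have : (n : ℝ) ≤ x.2 := by exact_mod_cast hx.2
          linarith)).trans_lt hn
  obtain ⟨i₁, hi₁⟩ := exists_eventually_of_finite U (fun x i₁ => i x = i₁)
    (Eventually.of_forall fun x => ⟨i x, rfl⟩)
  obtain ⟨W, hw, hlim⟩ := exists_weighting_of_approximation U hlt hα u w hu huw
  obtain ⟨i', e', he'⟩ := W.exists_weight_pos hirr hN
  set L : W.Label := ⟨i', e', ⟨0, he'⟩⟩ with hL
  obtain ⟨γ, hγ, V, k₀, hdesc⟩ := W.exists_rot_desc (L := L) hirr rfl i₁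
  -- At time zero the flow has a single tile, while approximating two tiles injectively requires
  -- two.
  have htpos : ∀ᶠ x in U, 0 < t x := by
    obtain ⟨T, hT, T', hT', hne⟩ := (h𝒯.isTiling.infinite hd).nontrivial
    filter_upwards [hmem ⟨T, hT⟩, hmem ⟨T', hT'⟩] with x hx hx'
    refine (ht x).lt_of_ne' fun h0 => hne ?_
    obtain ⟨c, hc, hfc⟩ := hflow x _ hx
    obtain ⟨c', hc', hfc'⟩ := hflow x _ hx'
    rw [h0] at hc hc'
    rw [eq_root_of_mem_flow_zero hd hvol hc] at hfc
    rw [eq_root_of_mem_flow_zero hd hvol hc'] at hfc'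
    exact congrArg Subtype.val (hinj x hx hx' (hfc.trans hfc'.symm))
  set s : Finset 𝒯 × ℕ → ℝ := fun x => Real.exp (W.u i₁ - u x i₁) with hs
  have hembed : ∀ x, (i x = i₁ ∧ w x = W.w ∧ 0 < t x) → ∃ (M : ℕ) (z : E d),
      ∀ c ∈ σ.flow (t x) (i x), ∃ l, (l, (fun y => z + s x • y) '' c.support σ.tile) ∈
        (W.fixedRule hγ).labelledPatch (Real.exp α) M (W.labelEquiv L) := by
    rintro x ⟨hix, hwx, htx⟩
    obtain ⟨z, hz⟩ := hθ x i₁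
    rw [hix, add_sub_cancel_right] at hz
    rw [hix]
    refine W.exists_labelledPatch_of_flow hd hvol hγ rfl hdesc (hu x) (fun i e => ?_) htx hz
    rw [scale_eq_exp_of_log_eq (huw x i e), hwx]
    congr 1
    ring
  choose! M z hMz using hembed
  have hgood : ∀ᶠ x in U, i x = i₁ ∧ w x = W.w ∧ 0 < t x := hi₁.and (hw.and htpos)
  have hlab : ∀ T : 𝒯, ∃ l, ∀ᶠ x in U, (l, (fun y => z x + s x • y) '' f x T) ∈
      (W.fixedRule hγ).labelledPatch (Real.exp α) (M x) (W.labelEquiv L) := fun T => by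
    refine exists_eventually_of_finite U _ ?_
    filter_upwards [hgood, hmem T] with x hx hTx
    obtain ⟨c, hc, hfc⟩ := hflow x T hTx
    rw [hfc]
    exact hMz x hx c hc
  choose lab hlab using hlab
  have hforget : forgetLabels (Set.range fun T : 𝒯 => (lab T, T.1)) = 𝒯 := by
    rw [forgetLabels, ← Set.range_comp]
    exact Subtype.range_coe
  refine ⟨W.fixedRule hγ, Real.exp α, Set.range fun T : 𝒯 => (lab T, T.1),
    W.isFixedScale_fixedRule hγ, W.isPrimitive_fixedRule hγ hirr hN,
    ⟨⟨by rw [hforget]; exact h𝒯.isTiling, ?_⟩, fun P hP hfin ε hε => ?_⟩, hforget.symm⟩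
  · rintro _ ⟨T, rfl⟩ _ ⟨T', rfl⟩ hTT
    obtain rfl : T = T' := Subtype.ext hTT
    rfl
  have hP𝒯 : ∀ p ∈ P, ∃ hp : p.2 ∈ 𝒯, p.1 = lab ⟨p.2, hp⟩ := fun p hp => by
    obtain ⟨T, rfl⟩ := hP hp
    exact ⟨T.2, rfl⟩
  -- Approximation and rescaling contribute `δ` each; `2 * δ` must be strictly below both `ε` and
  -- `1`.
  set δ := min ε 1 / 4 with hδ
  have hδpos : 0 < δ := by positivity
  have hδ1 : 4 * δ ≤ 1 := by rw [hδ]; linarith [min_le_right ε 1]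
  have hδε : 4 * δ ≤ ε := by rw [hδ]; linarith [min_le_left ε 1]
  have hbdd : Bornology.IsBounded (⋃ p ∈ P, p.2) := (Bornology.isBounded_biUnion hfin).2
    fun p hp => (h𝒯.isTiling.isTile _ (hP𝒯 p hp).1).isCompact.isBounded
  obtain ⟨R, hR⟩ := hbdd.subset_closedBall 0
  obtain ⟨D, hD⟩ := exists_dist_le_of_mem_flow hd hvol
  have hev : ∀ p ∈ P, ∀ᶠ x in U, ∃ hp : p.2 ∈ 𝒯, ⟨p.2, hp⟩ ∈ x.1 ∧
      Close δ p.2 (translate (v x) (f x ⟨p.2, hp⟩)) ∧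
      (p.1, (fun y => z x + s x • y) '' f x ⟨p.2, hp⟩) ∈
        (W.fixedRule hγ).labelledPatch (Real.exp α) (M x) (W.labelEquiv L) := fun p hp => by
    obtain ⟨hp𝒯, hlabp⟩ := hP𝒯 p hp
    have htile := h𝒯.isTiling.isTile _ hp𝒯
    obtain ⟨η, hη, hclose⟩ := exists_close_of_cfDist_lt htile.isCompact.isBounded htile.nonempty D
      hδpos
    filter_upwards [hmem ⟨p.2, hp𝒯⟩, hprec η hη, hlab ⟨p.2, hp𝒯⟩] with x hx hηx hlx
    refine ⟨hp𝒯, hx, hclose _ ?_ ((hcf x _ hx).trans hηx), by rw [hlabp]; exact hlx⟩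
    obtain ⟨c, hc, hfc⟩ := hflow x _ hx
    rw [hfc]
    exact hD _ _ c hc _
  have hscale : ∀ᶠ x in U, |s x - 1| * (|R| + 1) < δ := by
    have h1 : Tendsto s U (𝓝 (Real.exp (W.u i₁ - W.u i₁))) :=
      (Real.continuous_exp.tendsto _).comp (tendsto_const_nhds.sub (hlim i₁))
    rw [sub_self, Real.exp_zero] at h1
    have h2 : Tendsto (fun x => |s x - 1| * (|R| + 1)) U (𝓝 (|1 - 1| * (|R| + 1))) :=
      ((h1.sub_const 1).abs).mul_const _
    rw [sub_self, abs_zero, zero_mul] at h2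
    exact h2.eventually (gt_mem_nhds hδpos)
  obtain ⟨x, hx, hsx⟩ := (((eventually_all_finite hfin).2 hev).and hscale).exists
  have hspos : 0 < s x := Real.exp_pos _
  have hinjA : Function.Injective fun y : E d => z x + s x • y := fun y y' hy =>
    smul_right_injective _ hspos.ne' (add_right_injective (z x) hy)
  -- The shift removes `z x` and turns the embedded tile into `s x` times the approximating
  -- translate. The value of the map off the tiles is arbitrary.
  refine ⟨_, by rw [generatingLabelledPatches_eq]; exact ⟨M x, W.labelEquiv L, rfl⟩,
    s x • v x - z x, fun p => if hp : p.2 ∈ 𝒯 then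
      (p.1, (fun y => z x + s x • y) '' f x ⟨p.2, hp⟩) else p, ?_, ?_, ?_⟩
  · intro p hp q hq hpq
    obtain ⟨hp', hpx, -⟩ := hx p hp
    obtain ⟨hq', hqx, -⟩ := hx q hq
    simp only [dif_pos hp', dif_pos hq', Prod.mk.injEq] at hpq
    have := hinj x hpx hqx (Set.image_injective.2 hinjA hpq.2)
    exact Prod.ext hpq.1 (congrArg Subtype.val this)
  · intro p hp
    obtain ⟨hp', -, -, h1⟩ := hx p hp
    simp only [dif_pos hp']
    exact h1
  · intro p hp
    obtain ⟨hp', hpx, hclose, -⟩ := hx p hp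
    simp only [dif_pos hp', true_and]
    have h1 := close_smul ((Set.subset_biUnion_of_mem (u := fun p : _ × Set (E d) => p.2)
      hp).trans hR) (by linarith) hclose hsx
    have h2 : translate (s x • v x - z x) ((fun y => z x + s x • y) '' f x ⟨p.2, hp'⟩) =
        (fun y => s x • y) '' translate (v x) (f x ⟨p.2, hp'⟩) := by
      simp only [translate, Set.image_image]
      refine Set.image_congr fun y _ => ?_
      rw [smul_add]
      abel
    rw [h2]
    exact cfDist_lt_of_close (by linarith) (by linarith) (by linarith) h1

end SubstitutionRule

theorem dilate_one {d : ℕ} (T : Set (E d)) : dilate 1 T = T := by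
  simp [dilate]

end MultiscaleTiling

end

theorem proposition3p6 {d : ℕ} (hd : 0 < d)
    (Γ : Subgroup (MultiscaleTiling.E d ≃ₗᵢ[ℝ] MultiscaleTiling.E d))
    (σ : MultiscaleTiling.SubstitutionRule d Γ)
    (hmulti : σ.IsMultiscale) (hirr : σ.IsIrreducible) (hcomm : σ.IsCommensurable)
    (𝒯 : Set (Set (MultiscaleTiling.E d)))
    (h𝒯 : MultiscaleTiling.IsMultiscaleSubstitutionTiling σ 𝒯) :
    ∃ (ρ : MultiscaleTiling.SubstitutionRule d Γ) (ξ : ℝ)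
      (𝒯prim : Set (Fin ρ.n × Set (MultiscaleTiling.E d))) (c : ℝ),
      ρ.IsFixedScale ξ ∧ ρ.IsPrimitive ∧
      MultiscaleTiling.IsSubstitutionTiling ρ ξ 𝒯prim ∧
      (Γ = ⊥ → MultiscaleTiling.HasFiniteLocalComplexity 𝒯 →
        ∀ P ⊆ 𝒯prim, P.Finite → MultiscaleTiling.IsTranslatedLabelledSubpatch
          (ρ.generatingLabelledPatches ξ) P) ∧
      0 < c ∧ 𝒯 = MultiscaleTiling.dilate c '' MultiscaleTiling.forgetLabels 𝒯prim := by
  obtain ⟨ρ, ξ, 𝒯', hρ, hprim, h𝒯', rfl⟩ :=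
    MultiscaleTiling.SubstitutionRule.exists_fixedScale_of_commensurable hd σ hmulti hirr hcomm
      𝒯 h𝒯
  -- The sizes `exp (u)` of the prototiles absorb the dilation, so `c = 1`.
  refine ⟨ρ, ξ, 𝒯', 1, hρ, hprim, h𝒯', fun hΓ hflc P hP hfin =>
    MultiscaleTiling.SubstitutionRule.isTranslatedLabelledSubpatch_of_trivial_group hd hΓ hρ hprim
      h𝒯' hflc hP hfin, one_pos, ?_⟩
  simp only [MultiscaleTiling.dilate_one, Set.image_id']
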